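/- Let $\mathcal G$ be a locally compact Hausdorff étale groupoid with unit space $\mathcal G^{(0)}$, range and source maps $r,s$, and let $\mu$ be a probability Radon measure on $\mathcal G^{(0)}$. A bisection is a subset $B\subseteq\mathcal G$ on which $s$ and $r$ restrict to homeomorphisms onto their images; put $\alpha_B:=r\circ(s|_B)^{-1}:s(B)\to r(B)$ and $\mathrm{Fix}(\alpha_B):=\{x\in s(B):\alpha_B(x)=x\}$. Assume that $\mu$ is invariant, i.e. $\mu|_{r(B)}=(\alpha_B)_*(\mu|_{s(B)})$ for every open bisection $B$. Let $C_c(\mathcal G)$ be the convolution $*$-algebra, $(f*g)(\gamma)=\sum_{\alpha\in\mathcal G_{s(\gamma)}}f(\gamma\alpha^{-1})g(\alpha)$, $f^*(\gamma)=\overline{f(\gamma^{-1})}$, where $\mathcal G_x=s^{-1}(x)$. The reduced norm is $\|f\|_r=\sup_{x\in\mathcal G^{(0)}}\|\lambda_x(f)\|$, where $\lambda_x$ is the left regular representation on $\ell^2(\mathcal G_x)$, $(\lambda_x(f)\xi)(\gamma)=\sum_{\alpha\in\mathcal G_x}f(\gamma\alpha^{-1})\xi(\alpha)$; the maximal norm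 is $\|f\|_{\max}=\sup_\pi\|\pi(f)\|$ over all $*$-representations $\pi$ on Hilbert spaces that are contractive for $\|f\|_I=\max\{\sup_x\sum_{\gamma\in\mathcal G_x}|f(\gamma)|,\ \sup_x\sum_{\gamma\in\mathcal G_x}|f^*(\gamma)|\}$. For a $C^*$-norm $\|\cdot\|_\nu$ on $C_c(\mathcal G)$ dominating $\|\cdot\|_r$, let $C^*_\nu(\mathcal G)$ be the completion; write $C^*_r(\mathcal G)$ and $C^*(\mathcal G)$ for the completions with respect to $\|\cdot\|_r$ and $\|\cdot\|_{\max}$. Let $q_\nu:C^*_\nu(\mathcal G)\to C^*_r(\mathcal G)$ be the canonical map extending the identity of $C_c(\mathcal G)$, and let $E:C_r^*(\mathcal G)\to C_0(\mathcal G^{(0)})$, $E(a)(u)=\langle\lambda_u(a)\delta_u,\delta_u\rangle$, be the canonical conditional expectation. A tracial state $\tau$ on $C^*_\nu(\mathcal G)$ has associated measure $\mu_\tau$, the probability Radon measure on $\mathcal G^{(0)}$ with $\tau(f)=\int f\,d\mu_\tau$ for all functions $f$ on $\mathcal G^{(0)}$ that are continuous and vanish at infinity (equivalently, for all continuous compactly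 supported $f$), and $\tau$ is called canonical if $\tau(a)=\int_{\mathcal G^{(0)}}E(q_\nu(a))\,d\mu_\tau$ for all $a\in C^*_\nu(\mathcal G)$. The groupoid $\mathcal G$ is called essentially free with respect to $\mu$ if $\mu(\mathrm{Fix}(\alpha_B))=0$ for every pre-compact open bisection $B\subseteq\mathcal G\setminus\mathcal G^{(0)}$. The fixed point trace $\tau^{\mathrm{Fix}}_\mu:C_c(\mathcal G)\to\mathbb C$ is the linear map determined by $\tau^{\mathrm{Fix}}_\mu(g)=\int_{\mathrm{Fix}(\alpha_B)}g\circ(s|_B)^{-1}\,d\mu$ whenever $g\in C_c(\mathcal G)$ has support in a pre-compact open bisection $B$. Then the following are equivalent: 1. $\mathcal G$ is essentially free with respect to $\mu$; 2. for every $C^*$-norm $\|\cdot\|_\nu$ on $C_c(\mathcal G)$ dominating the reduced norm, every tracial state on $C^*_\nu(\mathcal G)$ with associated measure $\mu$ is canonical, and $\tau^{\mathrm{Fix}}_\mu$ extends to a tracial state on $C^*_\nu(\mathcal G)$; 3. there is a $C^*$-norm $\|\cdot\|_\nu$ on $C_c(\mathcal G)$ dominating the reduced norm such that every tracial state on $C^*_\nu(\mathcal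 G)$ with associated measure $\mu$ is canonical, and $\tau^{\mathrm{Fix}}_\mu$ extends to a tracial state on $C^*_\nu(\mathcal G)$; 4. every tracial state on the maximal groupoid $C^*$-algebra $C^*(\mathcal G)$ with associated measure $\mu$ is canonical. -/

import Mathlib

universe u

namespace EtaleGroupoid

open scoped CompactlySupported

/-- A groupoid on the set of arrows `G`, with unit space a subset `units` of `G`, source and range
maps onto it, partially defined composition `comp a b` (for `src a = rng b`) and inversion. -/
class Gpd (G : Type u) where
  /-- the unit space -/
  units : Set G
  /-- the source map -/
  src : G → units
  /-- the range map -/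
  rng : G → units
  /-- the product `ab`, defined when the source of `a` is the range of `b` -/
  comp : (a b : G) → src a = rng b → G
  /-- the inverse -/
  inv : G → G
  src_unit : ∀ x : units, src (x : G) = x
  rng_unit : ∀ x : units, rng (x : G) = x
  src_comp : ∀ a b (h : src a = rng b), src (comp a b h) = src b
  rng_comp : ∀ a b (h : src a = rng b), rng (comp a b h) = rng a
  comp_assoc : ∀ a b c (hab : src a = rng b) (hbc : src b = rng c),
    comp (comp a b hab) c ((src_comp a b hab).trans hbc) =
      comp a (comp b c hbc) (hab.trans (rng_comp b c hbc).symm)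
  rng_comp_self : ∀ a, comp (rng a : G) a (src_unit (rng a)) = a
  comp_src_self : ∀ a, comp a (src a : G) (rng_unit (src a)).symm = a
  src_inv : ∀ a, src (inv a) = rng a
  rng_inv : ∀ a, rng (inv a) = src a
  inv_comp_self : ∀ a, comp (inv a) a (src_inv a) = (src a : G)
  comp_inv_self : ∀ a, comp a (inv a) (rng_inv a).symm = (rng a : G)

/-- The unit space, as a type. -/
abbrev UnitSpace (G : Type u) [Gpd G] : Type u := (Gpd.units : Set G)

open Gpd

/-- A topological groupoid: the unit space has the subspace topology and all structure maps
are continuous. -/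
class TopGpd (G : Type u) [TopologicalSpace G] extends Gpd G where
  continuous_src : Continuous (src : G → UnitSpace G)
  continuous_rng : Continuous (rng : G → UnitSpace G)
  continuous_inv : Continuous (inv : G → G)
  continuous_comp : Continuous
    fun p : {p : G × G // src p.1 = rng p.2} => comp p.1.1 p.1.2 p.2

/-- A topological groupoid is étale if its range map is a local homeomorphism onto the unit
space. -/
class IsEtale (G : Type u) [TopologicalSpace G] [TopGpd G] : Prop where
  isLocalHomeomorph_rng : IsLocalHomeomorph (rng : G → UnitSpace G)

section Algebra

variable {G : Type u} [Gpd G]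

theorem comp_congr {a a' b b' : G} (ha : a = a') (hb : b = b') (h : src a = rng b) :
    comp a b h = comp a' b' (by rw [← ha, ← hb, h]) := by
  subst ha; subst hb; rfl

theorem inv_comp_cancel (a b : G) (h : src a = rng b) :
    comp (inv a) (comp a b h) ((src_inv a).trans (rng_comp a b h).symm) = b := by
  rw [← comp_assoc (inv a) a b (src_inv a) h, comp_congr (inv_comp_self a) rfl]
  rw [comp_congr (congrArg _ h) rfl, rng_comp_self]

theorem comp_inv_cancel (a b : G) (h : src a = rng b) :
    comp (comp a b h) (inv b) ((src_comp a b h).trans (rng_inv b).symm) = a := by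
  rw [comp_assoc a b (inv b) h (rng_inv b).symm, comp_congr rfl (comp_inv_self b)]
  rw [comp_congr rfl (congrArg _ h.symm), comp_src_self]

theorem inv_inv' (a : G) : inv (inv a) = a := by
  have h := inv_comp_cancel (inv a) a (src_inv a)
  rw [comp_congr rfl (inv_comp_self a)] at h
  have e : src (inv (inv a)) = src a := by rw [src_inv, rng_inv]
  rw [comp_congr rfl (congrArg Subtype.val e.symm), comp_src_self] at h
  exact h

theorem comp_left_cancel {a b c : G} (h : src a = rng b) (h' : src a = rng c)
    (e : comp a b h = comp a c h') : b = c := by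
  rw [← inv_comp_cancel a b h, comp_congr rfl e, inv_comp_cancel]

theorem eq_inv_of_comp {a b : G} (h : src a = rng b) {x : UnitSpace G}
    (e : comp a b h = (x : G)) : b = inv a := by
  have hx : x = rng a := by
    have := congrArg rng e
    rw [rng_comp, rng_unit] at this
    exact this.symm
  refine comp_left_cancel h (rng_inv a).symm ?_
  rw [e, comp_inv_self, hx]

/-- The set `G_x` of arrows with source `x`, as a type. -/
abbrev Fiber (x : UnitSpace G) : Type u := {γ : G // src γ = x}

/-- The unit `x` as an element of `G_x`. -/
def unitFiber (x : UnitSpace G) : Fiber x := ⟨x, src_unit x⟩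

/-- For `γ, α ∈ G_x`, the arrow `γ α⁻¹`. -/
def div {x : UnitSpace G} (γ α : Fiber x) : G :=
  comp γ.1 (inv α.1) (by rw [rng_inv, γ.2, α.2])

variable {x : UnitSpace G}

theorem src_div (γ α : Fiber x) : src (div γ α) = rng α.1 := by
  rw [div, src_comp, src_inv]

theorem rng_div (γ α : Fiber x) : rng (div γ α) = rng γ.1 := by
  rw [div, rng_comp]

theorem div_comp (γ α : Fiber x) : comp (div γ α) α.1 (src_div γ α) = γ.1 := by
  have := comp_inv_cancel γ.1 (inv α.1) (by rw [rng_inv, γ.2, α.2])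
  rw [comp_congr rfl (inv_inv' α.1)] at this
  exact this

theorem div_comp_div (γ β α : Fiber x) :
    comp (div γ β) (div β α) ((src_div γ β).trans (rng_div β α).symm) = div γ α := by
  have h := comp_assoc (div γ β) β.1 (inv α.1) (src_div γ β) (by rw [rng_inv, β.2, α.2])
  rw [comp_congr (div_comp γ β) rfl] at h
  exact h.symm

theorem div_self (γ : Fiber x) : div γ γ = (rng γ.1 : G) := comp_inv_self _

theorem inv_div (γ α : Fiber x) : inv (div γ α) = div α γ :=
  (eq_inv_of_comp _ ((div_comp_div γ α γ).trans (div_self γ))).symm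

theorem div_unit (γ : Fiber x) : div γ (unitFiber x) = γ.1 := by
  have h := div_comp γ (unitFiber x)
  have h2 : (unitFiber x).1 = ((src (div γ (unitFiber x)) : UnitSpace G) : G) := by
    rw [src_div]; simp [unitFiber, rng_unit]
  rw [comp_congr rfl h2, comp_src_self] at h
  exact h

/-- Right translation identifies `G_x` with `G_{r(α)}` for `α ∈ G_x`. -/
def divEquiv (α : Fiber x) : Fiber x ≃ Fiber (rng α.1) where
  toFun β := ⟨div β α, src_div β α⟩
  invFun δ := ⟨comp δ.1 α.1 δ.2, by rw [src_comp, α.2]⟩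
  left_inv β := Subtype.ext (div_comp β α)
  right_inv δ := Subtype.ext (comp_inv_cancel δ.1 α.1 δ.2)

theorem div_div_div (γ β α : Fiber x) :
    div (divEquiv α γ) (divEquiv α β) = div γ β := by
  have h : div (divEquiv α γ) (divEquiv α β) =
      comp (div γ α) (inv (div β α)) (by rw [src_div, rng_inv, src_div]) := rfl
  rw [h, comp_congr rfl (inv_div β α), div_comp_div]

theorem div_left_injective (γ : Fiber x) : Function.Injective (div γ : Fiber x → G) := by
  intro α β h
  have h1 := congrArg inv h
  rw [inv_div, inv_div] at h1
  apply Subtype.ext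
  rw [← div_comp α γ, comp_congr h1 rfl, div_comp]

theorem div_right_injective (γ : Fiber x) :
    Function.Injective (fun α : Fiber x => div α γ) := by
  intro α β h
  have h1 : div α γ = div β γ := h
  apply Subtype.ext
  rw [← div_comp α γ, comp_congr h1 rfl, div_comp]

end Algebra

section Topology

open Set Topology

/-- A bisection: source and range restrict to homeomorphisms onto their images. -/
def IsBisection {G : Type u} [TopologicalSpace G] [TopGpd G] (B : Set G) : Prop :=
  IsEmbedding (B.domRestrict (src : G → UnitSpace G)) ∧
    IsEmbedding (B.domRestrict (rng : G → UnitSpace G))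

/-- A pre-compact open bisection. -/
structure IsPrecompactOpenBisection {G : Type u} [TopologicalSpace G] [TopGpd G]
    (B : Set G) : Prop where
  isOpen : IsOpen B
  isBisection : IsBisection B
  isCompact_closure : IsCompact (closure B)

theorem IsBisection.src_injOn {G : Type u} [TopologicalSpace G] [TopGpd G] {B : Set G}
    (hB : IsBisection B) : InjOn (src : G → UnitSpace G) B := injOn_iff_injective.2 hB.1.injective

theorem IsBisection.rng_injOn {G : Type u} [TopologicalSpace G] [TopGpd G] {B : Set G}
    (hB : IsBisection B) : InjOn (rng : G → UnitSpace G) B := injOn_iff_injective.2 hB.2.injective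

variable {G : Type u} [TopologicalSpace G] [TopGpd G] [IsEtale G]

theorem isLocalHomeomorph_src : IsLocalHomeomorph (src : G → UnitSpace G) := by
  let e : G ≃ₜ G :=
    { toFun := inv, invFun := inv, left_inv := inv_inv', right_inv := inv_inv'
      continuous_toFun := TopGpd.continuous_inv, continuous_invFun := TopGpd.continuous_inv }
  have h : (src : G → UnitSpace G) = rng ∘ e := by
    funext a; exact (rng_inv a).symm
  rw [h]
  exact IsEtale.isLocalHomeomorph_rng.comp e.isLocalHomeomorph

theorem isBisection_of_injOn {U : Set G} (hU : IsOpen U) (h1 : InjOn (src : G → UnitSpace G) U)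
    (h2 : InjOn (rng : G → UnitSpace G) U) : IsBisection U := by
  constructor
  · exact (IsOpenEmbedding.of_continuous_injective_isOpenMap
      (TopGpd.continuous_src.comp continuous_subtype_val) (injOn_iff_injective.1 h1)
      (isLocalHomeomorph_src.isOpenMap.comp hU.isOpenMap_subtype_val)).isEmbedding
  · exact (IsOpenEmbedding.of_continuous_injective_isOpenMap
      (TopGpd.continuous_rng.comp continuous_subtype_val) (injOn_iff_injective.1 h2)
      (IsEtale.isLocalHomeomorph_rng.isOpenMap.comp hU.isOpenMap_subtype_val)).isEmbedding

theorem exists_bisection [LocallyCompactSpace G] [T2Space G] (γ : G) :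
    ∃ U : Set G, γ ∈ U ∧ IsPrecompactOpenBisection U := by
  obtain ⟨e, he, hes⟩ := (isLocalHomeomorph_src (G := G)) γ
  obtain ⟨d, hd, hds⟩ := (IsEtale.isLocalHomeomorph_rng (G := G)) γ
  obtain ⟨K, hK, hKγ⟩ := exists_compact_mem_nhds γ
  refine ⟨e.source ∩ d.source ∩ interior K,
    ⟨⟨he, hd⟩, mem_interior_iff_mem_nhds.2 hKγ⟩, ?_, isBisection_of_injOn ?_ ?_ ?_, ?_⟩
  · exact (e.open_source.inter d.open_source).inter isOpen_interior
  · exact (e.open_source.inter d.open_source).inter isOpen_interior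
  · rw [hes]; exact e.injOn.mono fun x hx => hx.1.1
  · rw [hds]; exact d.injOn.mono fun x hx => hx.1.2
  · exact hK.of_isClosed_subset isClosed_closure
      (closure_minimal (inter_subset_right.trans interior_subset) hK.isClosed)

variable [LocallyCompactSpace G] [T2Space G]

theorem exists_cover {K : Set G} (hK : IsCompact K) :
    ∃ (n : ℕ) (U : Fin n → Set G), (∀ i, IsPrecompactOpenBisection (U i)) ∧ K ⊆ ⋃ i, U i := by
  choose U hU1 hU2 using exists_bisection (G := G)
  obtain ⟨t, -, ht⟩ := hK.elim_nhds_subcover U fun x _ => (hU2 x).isOpen.mem_nhds (hU1 x)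
  refine ⟨t.card, fun i => U (t.equivFin.symm i), fun i => hU2 _, fun x hx => ?_⟩
  obtain ⟨y, hy, hxy⟩ := mem_iUnion₂.1 (ht hx)
  exact mem_iUnion.2 ⟨t.equivFin ⟨y, hy⟩, by simpa using hxy⟩

theorem finite_inter_src {K : Set G} (hK : IsCompact K) (x : UnitSpace G) :
    {γ ∈ K | src γ = x}.Finite := by
  obtain ⟨n, U, hU, hKU⟩ := exists_cover hK
  refine (finite_iUnion (f := fun i => {γ ∈ U i | src γ = x}) fun i => ?_).subset ?_
  · refine Set.Subsingleton.finite fun a ha b hb => ?_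
    exact (hU i).isBisection.src_injOn ha.1 hb.1 (ha.2.trans hb.2.symm)
  · intro γ hγ
    obtain ⟨i, hi⟩ := mem_iUnion.1 (hKU hγ.1)
    exact mem_iUnion.2 ⟨i, hi, hγ.2⟩

theorem finite_inter_rng {K : Set G} (hK : IsCompact K) (x : UnitSpace G) :
    {γ ∈ K | rng γ = x}.Finite := by
  obtain ⟨n, U, hU, hKU⟩ := exists_cover hK
  refine (finite_iUnion (f := fun i => {γ ∈ U i | rng γ = x}) fun i => ?_).subset ?_
  · refine Set.Subsingleton.finite fun a ha b hb => ?_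
    exact (hU i).isBisection.rng_injOn ha.1 hb.1 (ha.2.trans hb.2.symm)
  · intro γ hγ
    obtain ⟨i, hi⟩ := mem_iUnion.1 (hKU hγ.1)
    exact mem_iUnion.2 ⟨i, hi, hγ.2⟩

theorem isOpen_units : IsOpen (units : Set G) := by
  rw [isOpen_iff_mem_nhds]
  intro u hu
  obtain ⟨U, huU, hU⟩ := exists_bisection u
  have hc : Continuous fun γ : G => ((rng γ : UnitSpace G) : G) :=
    continuous_subtype_val.comp TopGpd.continuous_rng
  have h2 : ((rng u : UnitSpace G) : G) ∈ U := by
    rw [rng_unit ⟨u, hu⟩]; exact huU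
  filter_upwards [hU.isOpen.mem_nhds huU, (hU.isOpen.preimage hc).mem_nhds h2] with γ h1 h3
  have : ((rng γ : UnitSpace G) : G) = γ :=
    hU.isBisection.rng_injOn h3 h1 (rng_unit _)
  rw [← this]; exact (rng γ).2

end Topology

/-- The space `C_c(G)`; its product will be the convolution. -/
def Cc (G : Type u) [TopologicalSpace G] : Type u := C_c(G, ℂ)

section Cc

open Set Topology

variable {G : Type u} [TopologicalSpace G]

noncomputable instance : AddCommGroup (Cc G) := inferInstanceAs (AddCommGroup C_c(G, ℂ))
noncomputable instance : Module ℂ (Cc G) := inferInstanceAs (Module ℂ C_c(G, ℂ))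
instance : FunLike (Cc G) G ℂ := inferInstanceAs (FunLike C_c(G, ℂ) G ℂ)

/-- Constructor of elements of `C_c(G)`. -/
def Cc.mk (f : G → ℂ) (hf : Continuous f) (hs : HasCompactSupport f) : Cc G :=
  (⟨⟨f, hf⟩, hs⟩ : C_c(G, ℂ))

@[simp] theorem Cc.mk_apply (f : G → ℂ) (hf : Continuous f) (hs : HasCompactSupport f) (γ : G) :
    Cc.mk f hf hs γ = f γ := rfl

@[ext] theorem Cc.ext {f g : Cc G} (h : ∀ γ, f γ = g γ) : f = g := DFunLike.ext _ _ h

theorem Cc.continuous (f : Cc G) : Continuous f := (f : C_c(G, ℂ)).continuous_toFun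
theorem Cc.hasCompactSupport (f : Cc G) : HasCompactSupport f := (f : C_c(G, ℂ)).hasCompactSupport'

@[simp] theorem Cc.zero_apply (γ : G) : (0 : Cc G) γ = 0 := rfl
@[simp] theorem Cc.add_apply (f g : Cc G) (γ : G) : (f + g) γ = f γ + g γ := rfl
@[simp] theorem Cc.neg_apply (f : Cc G) (γ : G) : (-f) γ = -f γ := rfl
@[simp] theorem Cc.smul_apply (c : ℂ) (f : Cc G) (γ : G) : (c • f) γ = c * f γ := rfl
theorem Cc.sum_apply {ι : Type*} (s : Finset ι) (f : ι → Cc G) (γ : G) :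
    (∑ i ∈ s, f i) γ = ∑ i ∈ s, f i γ :=
  CompactlySupportedContinuousMap.sum_apply s (fun i => (f i : C_c(G, ℂ))) γ

theorem Cc.exists_bound (f : Cc G) : ∃ C, 0 ≤ C ∧ ∀ γ, ‖f γ‖ ≤ C := by
  obtain ⟨C, hC⟩ := f.hasCompactSupport.exists_bound_of_continuous f.continuous
  exact ⟨max C 0, le_max_right _ _, fun γ => (hC γ).trans (le_max_left _ _)⟩

variable [TopGpd G] [IsEtale G] [LocallyCompactSpace G] [T2Space G]

/-- Every function in `C_c(G)` is a sum of functions supported in pre-compact open bisections. -/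
theorem Cc.exists_decomposition (f : Cc G) : ∃ (n : ℕ) (U : Fin n → Set G) (g : Fin n → Cc G),
    (∀ i, IsPrecompactOpenBisection (U i)) ∧ (∀ i, tsupport (g i) ⊆ U i) ∧ f = ∑ i, g i := by
  obtain ⟨n, U, hU, hKU⟩ := exists_cover f.hasCompactSupport.isCompact
  obtain ⟨ρ, hρ, hρ1, -, -⟩ := exists_continuous_sum_one_of_isOpen_isCompact
    (fun i => (hU i).isOpen) f.hasCompactSupport.isCompact hKU
  refine ⟨n, U, fun i => Cc.mk (fun γ => (ρ i γ : ℂ) * f γ)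
    ((Complex.continuous_ofReal.comp (ρ i).continuous).mul f.continuous)
    f.hasCompactSupport.mul_left, hU, fun i => ?_, ?_⟩
  · refine Subset.trans (closure_mono ?_) (hρ i)
    intro γ hγ h0
    exact hγ (by simp [h0])
  · ext γ
    rw [Cc.sum_apply]
    simp only [Cc.mk_apply, ← Finset.sum_mul]
    by_cases h : f γ = 0
    · simp [h]
    · have h1 := hρ1 (subset_tsupport _ h : γ ∈ tsupport f)
      simp only [Finset.sum_apply, Pi.one_apply] at h1
      rw [← Complex.ofReal_sum, h1]; simp

theorem Cc.induction {P : Cc G → Prop} (h0 : P 0) (hadd : ∀ f g, P f → P g → P (f + g))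
    (hB : ∀ (B : Set G) (f : Cc G), IsPrecompactOpenBisection B → tsupport f ⊆ B → P f)
    (f : Cc G) : P f := by
  obtain ⟨n, U, g, hU, hg, rfl⟩ := f.exists_decomposition
  exact Finset.sum_induction g P hadd h0 fun i _ => hB _ _ (hU i) (hg i)

end Cc

section Convolution

set_option linter.unusedSectionVars false

open Set Topology

variable {G : Type u} [TopologicalSpace G] [TopGpd G]

/-- The convolution `(f * g)(γ) = ∑_{α ∈ G_{s(γ)}} f(γ α⁻¹) g(α)`. -/
noncomputable def conv (f g : G → ℂ) (γ : G) : ℂ :=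
  ∑ᶠ α : Fiber (src γ), f (div ⟨γ, rfl⟩ α) * g α.1

/-- The action of `f` on functions on `G_x`:
`(λ_x(f) ξ)(γ) = ∑_{α ∈ G_x} f(γ α⁻¹) ξ(α)`. -/
noncomputable def fiberConv (f : G → ℂ) {x : UnitSpace G} (ξ : Fiber x → ℂ) (γ : Fiber x) : ℂ :=
  ∑ᶠ α : Fiber x, f (div γ α) * ξ α

theorem conv_fiber (f g : G → ℂ) {x : UnitSpace G} (γ : Fiber x) :
    conv f g γ.1 = fiberConv f (fun α : Fiber x => g α.1) γ := by
  obtain ⟨γ, rfl⟩ := γ; rfl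

theorem conv_div (f g : G → ℂ) {x : UnitSpace G} (γ α : Fiber x) :
    conv f g (div γ α) = ∑ᶠ β : Fiber x, f (div γ β) * g (div β α) := by
  have h := conv_fiber f g (divEquiv α γ)
  have h' : (divEquiv α γ).1 = div γ α := rfl
  rw [h'] at h
  rw [h, fiberConv, ← finsum_comp_equiv (divEquiv α)]
  refine finsum_congr fun β => ?_
  rw [div_div_div]; rfl

variable [IsEtale G] [LocallyCompactSpace G] [T2Space G]

theorem Cc.finite_fiber (f : Cc G) (x : UnitSpace G) :
    {α : Fiber x | f α.1 ≠ 0}.Finite := by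
  refine ((finite_inter_src f.hasCompactSupport.isCompact x).preimage
    Subtype.val_injective.injOn).subset fun α hα => ?_
  exact ⟨subset_tsupport _ hα, α.2⟩

theorem Cc.finite_left (f : Cc G) {x : UnitSpace G} (γ : Fiber x) :
    {α : Fiber x | f (div γ α) ≠ 0}.Finite := by
  refine ((finite_inter_rng f.hasCompactSupport.isCompact (rng γ.1)).preimage
    (div_left_injective γ).injOn).subset fun α hα => ?_
  exact ⟨subset_tsupport _ hα, rng_div _ _⟩

theorem Cc.finite_right (f : Cc G) {x : UnitSpace G} (α : Fiber x) :
    {γ : Fiber x | f (div γ α) ≠ 0}.Finite := by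
  refine ((finite_inter_src f.hasCompactSupport.isCompact (rng α.1)).preimage
    (div_right_injective α).injOn).subset fun γ hγ => ?_
  exact ⟨subset_tsupport _ hγ, src_div _ _⟩

theorem finite_support_fiberConv (f : Cc G) {x : UnitSpace G} (ξ : Fiber x → ℂ) (γ : Fiber x) :
    (Function.support fun α : Fiber x => f (div γ α) * ξ α).Finite :=
  (f.finite_left γ).subset fun _ hα => left_ne_zero_of_mul hα

theorem fiberConv_add_left (f g : Cc G) {x : UnitSpace G} (ξ : Fiber x → ℂ) (γ : Fiber x) :
    fiberConv (f + g : Cc G) ξ γ = fiberConv f ξ γ + fiberConv g ξ γ := by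
  unfold fiberConv
  rw [← finsum_add_distrib (finite_support_fiberConv f ξ γ) (finite_support_fiberConv g ξ γ)]
  exact finsum_congr fun α => by simp [add_mul]

theorem fiberConv_add_right (f : Cc G) {x : UnitSpace G} (ξ η : Fiber x → ℂ) (γ : Fiber x) :
    fiberConv f (ξ + η) γ = fiberConv f ξ γ + fiberConv f η γ := by
  unfold fiberConv
  rw [← finsum_add_distrib (finite_support_fiberConv f ξ γ) (finite_support_fiberConv f η γ)]
  exact finsum_congr fun α => by simp [mul_add]

theorem fiberConv_smul_left (c : ℂ) (f : Cc G) {x : UnitSpace G} (ξ : Fiber x → ℂ)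
    (γ : Fiber x) : fiberConv (c • f : Cc G) ξ γ = c * fiberConv f ξ γ := by
  unfold fiberConv
  refine Eq.trans (finsum_congr fun α => ?_) (smul_finsum c _).symm
  simp [mul_assoc]

theorem fiberConv_smul_right (c : ℂ) (f : Cc G) {x : UnitSpace G} (ξ : Fiber x → ℂ)
    (γ : Fiber x) : fiberConv f (c • ξ) γ = c * fiberConv f ξ γ := by
  unfold fiberConv
  refine Eq.trans (finsum_congr fun α => ?_) (smul_finsum c _).symm
  simp [mul_left_comm]

theorem fiberConv_conv (f g : Cc G) {x : UnitSpace G} (ξ : Fiber x → ℂ) (γ : Fiber x) :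
    fiberConv (conv f g) ξ γ = fiberConv f (fiberConv g ξ) γ := by
  classical
  set S := (f.finite_left γ).toFinset with hS
  have hSm : ∀ β, β ∉ S → f (div γ β) = 0 := fun β hβ => by simpa [hS] using hβ
  set T : Finset (Fiber x) := S.biUnion fun β => (g.finite_left β).toFinset with hT
  have hTm : ∀ α, α ∉ T → ∀ β ∈ S, g (div β α) = 0 := fun α hα β hβ => by
    by_contra h
    exact hα (Finset.mem_biUnion.2 ⟨β, hβ, by simpa using h⟩)
  have e1 : ∀ α, conv f g (div γ α) = ∑ β ∈ S, f (div γ β) * g (div β α) := fun α => by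
    rw [conv_div]
    refine finsum_eq_sum_of_support_subset _ fun β hβ => ?_
    by_contra h
    exact hβ (by simp [hSm β h])
  have e2 : fiberConv (conv f g) ξ γ = ∑ α ∈ T, conv f g (div γ α) * ξ α := by
    refine finsum_eq_sum_of_support_subset _ fun α hα => ?_
    by_contra h
    refine hα ?_
    simp only [e1]
    rw [Finset.sum_eq_zero (fun β hβ => by rw [hTm α h β hβ, mul_zero]), zero_mul]
  have e3 : fiberConv f (fiberConv g ξ) γ = ∑ β ∈ S, f (div γ β) * fiberConv g ξ β := by
    refine finsum_eq_sum_of_support_subset _ fun β hβ => ?_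
    by_contra h
    exact hβ (by simp [hSm β h])
  have e4 : ∀ β ∈ S, fiberConv g ξ β = ∑ α ∈ T, g (div β α) * ξ α := fun β hβ => by
    refine finsum_eq_sum_of_support_subset _ fun α hα => ?_
    by_contra h
    exact hα (by simp [hTm α h β hβ])
  have e5 : ∑ β ∈ S, f (div γ β) * fiberConv g ξ β =
      ∑ β ∈ S, f (div γ β) * ∑ α ∈ T, g (div β α) * ξ α :=
    Finset.sum_congr rfl fun β hβ => by rw [e4 β hβ]
  rw [e2, e3, e5]
  simp only [e1, Finset.sum_mul, Finset.mul_sum]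
  rw [Finset.sum_comm]
  exact Finset.sum_congr rfl fun _ _ => Finset.sum_congr rfl fun _ _ => mul_assoc _ _ _

theorem continuous_conv (f g : Cc G) : Continuous (conv f g) := by
  induction g using Cc.induction with
  | h0 =>
    have : conv f (0 : Cc G) = fun _ => 0 := by
      funext γ; simp [conv]
    rw [this]; exact continuous_const
  | hadd g h hg hh =>
    have : conv f (g + h : Cc G) = fun γ => conv f g γ + conv f h γ := by
      funext γ
      exact fiberConv_add_right f (fun α : Fiber (src γ) => g α.1) (fun α => h α.1) ⟨γ, rfl⟩
    rw [this]; exact hg.add hh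
  | hB B g hB hg =>
    let e := hB.isBisection.1.toHomeomorph
    let O : Set G := {γ | src γ ∈ range (B.domRestrict (src : G → UnitSpace G))}
    have hO : IsOpen O := by
      have h1 : range (B.domRestrict (src : G → UnitSpace G)) = src '' B := by simp
      have := (isLocalHomeomorph_src (G := G)).isOpenMap B hB.isOpen
      rw [← h1] at this
      exact this.preimage TopGpd.continuous_src
    let σ : O → G := fun γ => (e.symm ⟨src γ.1, γ.2⟩ : B).1
    have hσc : Continuous σ :=
      continuous_subtype_val.comp (e.symm.continuous.comp
        (Continuous.subtype_mk (TopGpd.continuous_src.comp continuous_subtype_val) _))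
    have hσB : ∀ γ, σ γ ∈ B := fun γ => (e.symm ⟨src γ.1, γ.2⟩ : B).2
    have hσ : ∀ γ, src (σ γ) = src γ.1 := fun γ =>
      congrArg Subtype.val (e.apply_symm_apply ⟨src γ.1, γ.2⟩)
    have key : ∀ γ : O, conv f g γ.1 =
        f (comp γ.1 (inv (σ γ)) (by rw [rng_inv, hσ])) * g (σ γ) := by
      intro γ
      have : ∀ α : Fiber (src γ.1), α ≠ ⟨σ γ, hσ γ⟩ → f (div ⟨γ.1, rfl⟩ α) * g α.1 = 0 := by
        intro α hα
        by_cases h : g α.1 = 0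
        · rw [h, mul_zero]
        · exact absurd (Subtype.ext (hB.isBisection.src_injOn (hg (subset_tsupport _ h))
            (hσB γ) (α.2.trans (hσ γ).symm))) hα
      exact finsum_eq_single _ _ this
    rw [continuous_iff_continuousAt]
    intro γ
    by_cases hγ : γ ∈ O
    · refine ContinuousOn.continuousAt ?_ (hO.mem_nhds hγ)
      rw [continuousOn_iff_continuous_domRestrict]
      have : O.domRestrict (conv f g) = fun γ : O =>
          f (comp γ.1 (inv (σ γ)) (by rw [rng_inv, hσ])) * g (σ γ) := funext key
      rw [this]
      refine (f.continuous.comp ?_).mul (g.continuous.comp hσc)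
      exact TopGpd.continuous_comp.comp (Continuous.subtype_mk
        (continuous_subtype_val.prodMk (TopGpd.continuous_inv.comp hσc)) fun γ =>
          (hσ γ).symm.trans (rng_inv (σ γ)).symm)
    · have hK : IsCompact (src '' tsupport g) :=
        g.hasCompactSupport.isCompact.image TopGpd.continuous_src
      have hγ' : γ ∈ (src : G → UnitSpace G) ⁻¹' (src '' tsupport g)ᶜ := by
        rintro ⟨α, hα, hαγ⟩
        exact hγ ⟨⟨α, hg hα⟩, hαγ⟩
      have h0 : conv f g =ᶠ[𝓝 γ] fun _ => 0 := by
        filter_upwards [(hK.isClosed.isOpen_compl.preimage TopGpd.continuous_src).mem_nhds hγ']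
          with δ hδ
        refine finsum_eq_zero_of_forall_eq_zero fun α => ?_
        by_cases h : g α.1 = 0
        · rw [h, mul_zero]
        · exact absurd ⟨α.1, subset_tsupport _ h, α.2⟩ hδ
      exact continuousAt_const.congr h0.symm

theorem hasCompactSupport_conv (f g : Cc G) : HasCompactSupport (conv f g) := by
  have hcl : IsClosed {p : G × G | src p.1 = rng p.2} :=
    isClosed_eq (TopGpd.continuous_src.comp continuous_fst)
      (TopGpd.continuous_rng.comp continuous_snd)
  have hK := (hcl.isClosedEmbedding_subtypeVal.isCompact_preimage
    (f.hasCompactSupport.isCompact.prod g.hasCompactSupport.isCompact)).image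
    TopGpd.continuous_comp
  refine HasCompactSupport.intro hK fun γ hγ => ?_
  refine finsum_eq_zero_of_forall_eq_zero fun α => ?_
  by_contra h
  refine hγ ⟨⟨(div ⟨γ, rfl⟩ α, α.1), src_div _ _⟩, ⟨?_, ?_⟩, div_comp ⟨γ, rfl⟩ α⟩
  · exact subset_tsupport _ (left_ne_zero_of_mul h)
  · exact subset_tsupport _ (right_ne_zero_of_mul h)

noncomputable instance : Mul (Cc G) where
  mul f g := Cc.mk (conv f g) (continuous_conv f g) (hasCompactSupport_conv f g)

/-- The involution `f*(γ) = conj f(γ⁻¹)`. -/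
noncomputable instance : Star (Cc G) where
  star f := Cc.mk (fun γ => (starRingEnd ℂ) (f (inv γ)))
    (Complex.continuous_conj.comp (f.continuous.comp TopGpd.continuous_inv))
    (HasCompactSupport.intro (f.hasCompactSupport.isCompact.image TopGpd.continuous_inv)
      fun γ hγ => by
        have : f (inv γ) = 0 := by
          by_contra h
          exact hγ ⟨inv γ, subset_tsupport _ h, inv_inv' γ⟩
        simp [this])

theorem Cc.coe_mul (f g : Cc G) : ⇑(f * g) = conv f g := rfl
theorem Cc.star_apply (f : Cc G) (γ : G) : star f γ = (starRingEnd ℂ) (f (inv γ)) := rfl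

theorem Cc.mul_fiber (f g : Cc G) (γ : G) :
    (f * g) γ = fiberConv f (fun α : Fiber (src γ) => g α.1) ⟨γ, rfl⟩ := rfl

noncomputable instance : NonUnitalRing (Cc G) where
  left_distrib f g h := by
    ext γ; exact fiberConv_add_right f (fun α : Fiber (src γ) => g α.1) (fun α => h α.1) ⟨γ, rfl⟩
  right_distrib f g h := by
    ext γ; exact fiberConv_add_left f g (fun α : Fiber (src γ) => h α.1) ⟨γ, rfl⟩
  zero_mul f := by ext γ; simp [Cc.mul_fiber, fiberConv]
  mul_zero f := by ext γ; simp [Cc.mul_fiber, fiberConv]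
  mul_assoc f g h := by
    ext γ
    have : (fun α : Fiber (src γ) => (g * h) α.1) =
        fiberConv g (fun α : Fiber (src γ) => h α.1) := funext fun α => conv_fiber g h α
    rw [Cc.mul_fiber, Cc.mul_fiber f (g * h), this]
    exact fiberConv_conv f g _ _

instance : IsScalarTower ℂ (Cc G) (Cc G) where
  smul_assoc c f g := by
    ext γ; exact fiberConv_smul_left c f (fun α : Fiber (src γ) => g α.1) ⟨γ, rfl⟩

instance : SMulCommClass ℂ (Cc G) (Cc G) where
  smul_comm c f g := by
    ext γ; exact (fiberConv_smul_right c f (fun α : Fiber (src γ) => g α.1) ⟨γ, rfl⟩).symm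

noncomputable instance : StarRing (Cc G) where
  star_involutive f := by ext γ; simp [Cc.star_apply, inv_inv']
  star_add f g := by ext γ; simp [Cc.star_apply]
  star_mul f g := by
    ext γ
    let c : Fiber (src γ) := ⟨γ, rfl⟩
    let u : Fiber (src γ) := unitFiber (src γ)
    have h1 : inv γ = div u c := by rw [← inv_div, div_unit]
    have h2 : γ = div c u := (div_unit c).symm
    rw [Cc.star_apply, h1, Cc.coe_mul, conv_div]
    conv_rhs => rw [h2]
    rw [Cc.coe_mul, conv_div]
    have hf : (Function.support fun β => f (div u β) * g (div β c)).Finite :=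
      (f.finite_left u).subset fun β hβ => left_ne_zero_of_mul hβ
    have := (starRingEnd ℂ).toAddMonoidHom.map_finsum hf
    refine this.trans (finsum_congr fun β => ?_)
    rw [Cc.star_apply, Cc.star_apply, inv_div, inv_div]
    simp [mul_comm]

instance : StarModule ℂ (Cc G) where
  star_smul c f := by ext γ; simp [Cc.star_apply]

end Convolution

section Norms

open Set Topology

set_option linter.unusedSectionVars false

/-- The Hilbert space `ℓ²(G_x)`. -/
abbrev FiberL2 {G : Type u} [Gpd G] (x : UnitSpace G) : Type u := lp (fun _ : Fiber x => ℂ) 2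

variable {G : Type u} [TopologicalSpace G] [TopGpd G] [IsEtale G] [LocallyCompactSpace G]
  [T2Space G]

/-- The norm `‖f‖_I = max (sup_x ∑_{γ ∈ G_x} |f γ|) (sup_x ∑_{γ ∈ G_x} |f* γ|)`. -/
noncomputable def iNorm (f : Cc G) : ℝ :=
  max (⨆ x : UnitSpace G, ∑' γ : Fiber x, ‖f γ.1‖)
    (⨆ x : UnitSpace G, ∑' γ : Fiber x, ‖star f γ.1‖)

theorem Cc.summable_fiber (f : Cc G) (x : UnitSpace G) :
    Summable fun γ : Fiber x => ‖f γ.1‖ :=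
  summable_of_hasFiniteSupport ((f.finite_fiber x).subset fun γ hγ => by simpa using hγ)

theorem Cc.bddAbove_fiber (f : Cc G) :
    BddAbove (range fun x : UnitSpace G => ∑' γ : Fiber x, ‖f γ.1‖) := by
  induction f using Cc.induction with
  | h0 => exact ⟨0, by rintro _ ⟨x, rfl⟩; simp⟩
  | hadd f g hf hg =>
    obtain ⟨C, hC⟩ := hf
    obtain ⟨D, hD⟩ := hg
    refine ⟨C + D, ?_⟩
    rintro _ ⟨x, rfl⟩
    refine le_trans ?_ (add_le_add (hC ⟨x, rfl⟩) (hD ⟨x, rfl⟩))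
    simp only
    rw [← (f.summable_fiber x).tsum_add (g.summable_fiber x)]
    exact ((f + g).summable_fiber x).tsum_le_tsum (fun γ => norm_add_le _ _)
      ((f.summable_fiber x).add (g.summable_fiber x))
  | hB B f hB hf =>
    obtain ⟨C, hC0, hC⟩ := f.exists_bound
    refine ⟨C, ?_⟩
    rintro _ ⟨x, rfl⟩
    by_cases h : ∃ γ : Fiber x, f γ.1 ≠ 0
    · obtain ⟨γ, hγ⟩ := h
      have : ∀ δ : Fiber x, δ ≠ γ → ‖f δ.1‖ = 0 := by
        intro δ hδ
        by_contra h
        exact hδ (Subtype.ext (hB.isBisection.src_injOn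
          (hf (subset_tsupport _ (by simpa using h))) (hf (subset_tsupport _ hγ))
          (δ.2.trans γ.2.symm)))
      simp only
      rw [tsum_eq_single γ this]
      exact hC _
    · push Not at h
      simpa [h] using hC0

theorem tsum_fiber_le_iNorm (f : Cc G) (x : UnitSpace G) :
    ∑' γ : Fiber x, ‖f γ.1‖ ≤ iNorm f :=
  (le_ciSup f.bddAbove_fiber x).trans (le_max_left _ _)

theorem iNorm_star (f : Cc G) : iNorm (star f) = iNorm f := by
  rw [iNorm, star_star, max_comm, ← iNorm]

theorem iNorm_nonneg (f : Cc G) : 0 ≤ iNorm f :=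
  le_max_of_le_left (Real.iSup_nonneg fun _ => tsum_nonneg fun _ => norm_nonneg _)

theorem sum_div_le_iNorm (f : Cc G) {x : UnitSpace G} (α : Fiber x) (s : Finset (Fiber x)) :
    ∑ γ ∈ s, ‖f (div γ α)‖ ≤ iNorm f := by
  refine le_trans ?_ (tsum_fiber_le_iNorm f (rng α.1))
  rw [← (divEquiv α).tsum_eq (fun δ : Fiber (rng α.1) => ‖f δ.1‖)]
  exact ((divEquiv α).summable_iff.2 (f.summable_fiber (rng α.1))).sum_le_tsum s
    fun _ _ => norm_nonneg _

theorem sum_div_le_iNorm' (f : Cc G) {x : UnitSpace G} (γ : Fiber x) (s : Finset (Fiber x)) :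
    ∑ α ∈ s, ‖f (div γ α)‖ ≤ iNorm f := by
  rw [← iNorm_star]
  refine le_trans (le_of_eq (Finset.sum_congr rfl fun α _ => ?_)) (sum_div_le_iNorm (star f) γ s)
  rw [Cc.star_apply, inv_div]; simp

theorem sum_fiberConv_le (f : Cc G) {x : UnitSpace G} (ξ : FiberL2 x) (s : Finset (Fiber x)) :
    ∑ γ ∈ s, ‖fiberConv f ξ γ‖ ^ 2 ≤ (iNorm f * ‖ξ‖) ^ 2 := by
  classical
  set T : Finset (Fiber x) := s.biUnion fun γ => (f.finite_left γ).toFinset with hT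
  have hTm : ∀ γ ∈ s, fiberConv f ξ γ = ∑ α ∈ T, f (div γ α) * ξ α := fun γ hγ => by
    refine finsum_eq_sum_of_support_subset _ fun α hα => ?_
    refine Finset.mem_coe.2 (Finset.mem_biUnion.2 ⟨γ, hγ, ?_⟩)
    simpa using left_ne_zero_of_mul hα
  have h1 : ∀ γ ∈ s, ‖fiberConv f ξ γ‖ ^ 2 ≤
      iNorm f * ∑ α ∈ T, ‖f (div γ α)‖ * ‖ξ α‖ ^ 2 := fun γ hγ => by
    have h2 : ‖fiberConv f ξ γ‖ ≤ ∑ α ∈ T, ‖f (div γ α)‖ * ‖ξ α‖ := by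
      rw [hTm γ hγ]
      exact (norm_sum_le _ _).trans (le_of_eq (Finset.sum_congr rfl fun _ _ => norm_mul _ _))
    refine (pow_le_pow_left₀ (norm_nonneg _) h2 2).trans ?_
    refine (Finset.sum_sq_le_sum_mul_sum_of_sq_le_mul T (f := fun α => ‖f (div γ α)‖)
      (g := fun α => ‖f (div γ α)‖ * ‖ξ α‖ ^ 2) (fun _ _ => norm_nonneg _)
      (fun _ _ => by positivity) fun _ _ => le_of_eq (by ring)).trans ?_
    exact mul_le_mul_of_nonneg_right (sum_div_le_iNorm' f γ T)
      (Finset.sum_nonneg fun _ _ => by positivity)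
  calc ∑ γ ∈ s, ‖fiberConv f ξ γ‖ ^ 2
      ≤ ∑ γ ∈ s, iNorm f * ∑ α ∈ T, ‖f (div γ α)‖ * ‖ξ α‖ ^ 2 := Finset.sum_le_sum h1
    _ = iNorm f * ∑ α ∈ T, (∑ γ ∈ s, ‖f (div γ α)‖) * ‖ξ α‖ ^ 2 := by
        rw [← Finset.mul_sum, Finset.sum_comm]; simp only [Finset.sum_mul]
    _ ≤ iNorm f * ∑ α ∈ T, iNorm f * ‖ξ α‖ ^ 2 := by
        refine mul_le_mul_of_nonneg_left (Finset.sum_le_sum fun α _ => ?_) (iNorm_nonneg f)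
        exact mul_le_mul_of_nonneg_right (sum_div_le_iNorm f α s) (by positivity)
    _ = iNorm f ^ 2 * ∑ α ∈ T, ‖ξ α‖ ^ 2 := by rw [← Finset.mul_sum]; ring
    _ ≤ iNorm f ^ 2 * ‖ξ‖ ^ 2 := by
        refine mul_le_mul_of_nonneg_left ?_ (by positivity)
        have := lp.sum_rpow_le_norm_rpow (p := 2) (by norm_num) ξ T
        simpa using this
    _ = (iNorm f * ‖ξ‖) ^ 2 := by ring

theorem memℓp_fiberConv (f : Cc G) {x : UnitSpace G} (ξ : FiberL2 x) :
    Memℓp (fiberConv f ξ : Fiber x → ℂ) 2 :=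
  memℓp_gen' (C := (iNorm f * ‖ξ‖) ^ 2) fun s => by simpa using sum_fiberConv_le f ξ s

/-- The operator `λ_x(f)` on `ℓ²(G_x)`. -/
noncomputable def lamOp (x : UnitSpace G) (f : Cc G) : FiberL2 x →L[ℂ] FiberL2 x :=
  LinearMap.mkContinuous
    { toFun := fun ξ => ⟨fiberConv f ξ, memℓp_fiberConv f ξ⟩
      map_add' := fun ξ η => by
        apply Subtype.ext; funext γ
        exact fiberConv_add_right f (ξ : Fiber x → ℂ) η γ
      map_smul' := fun c ξ => by
        apply Subtype.ext; funext γ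
        exact fiberConv_smul_right c f (ξ : Fiber x → ℂ) γ }
    (iNorm f) fun ξ => by
      refine lp.norm_le_of_forall_sum_le (by norm_num)
        (mul_nonneg (iNorm_nonneg f) (norm_nonneg _)) fun s => ?_
      simpa using sum_fiberConv_le f ξ s

theorem lamOp_apply (x : UnitSpace G) (f : Cc G) (ξ : FiberL2 x) (γ : Fiber x) :
    lamOp x f ξ γ = fiberConv f ξ γ := rfl

theorem norm_lamOp_le (x : UnitSpace G) (f : Cc G) : ‖lamOp x f‖ ≤ iNorm f :=
  LinearMap.mkContinuous_norm_le _ (iNorm_nonneg f) _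

theorem lamOp_single [DecidableEq G] (x : UnitSpace G) (f : Cc G) (α γ : Fiber x) :
    lamOp x f (lp.single 2 α 1) γ = f (div γ α) := by
  rw [lamOp_apply, fiberConv, finsum_eq_single _ α]
  · simp
  · intro β hβ
    simp [hβ]

/-- The left regular representation `λ_x : C_c(G) → B(ℓ²(G_x))`. -/
noncomputable def lam (x : UnitSpace G) : Cc G →⋆ₙₐ[ℂ] (FiberL2 x →L[ℂ] FiberL2 x) where
  toFun := lamOp x
  map_smul' c f := by
    ext ξ γ; exact fiberConv_smul_left c f (ξ : Fiber x → ℂ) γ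
  map_zero' := by
    ext ξ γ
    rw [lamOp_apply]; simp [fiberConv]
  map_add' f g := by
    ext ξ γ; exact fiberConv_add_left f g (ξ : Fiber x → ℂ) γ
  map_mul' f g := by
    ext ξ γ; exact fiberConv_conv f g (ξ : Fiber x → ℂ) γ
  map_star' f := by
    classical
    ext ξ γ
    have h1 : (star (lamOp x f) ξ : FiberL2 x) γ =
        inner ℂ (lp.single 2 γ 1 : FiberL2 x) (star (lamOp x f) ξ) := by
      rw [lp.inner_single_left]; simp
    have h2 : inner ℂ (lp.single 2 γ 1 : FiberL2 x) (star (lamOp x f) ξ) =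
        inner ℂ (lamOp x f (lp.single 2 γ 1)) ξ :=
      ContinuousLinearMap.adjoint_inner_right _ _ _
    rw [h1, h2, lp.inner_eq_tsum, lamOp_apply, fiberConv]
    have hs : (Function.support fun α : Fiber x => star f (div γ α) * ξ α).Finite :=
      finite_support_fiberConv _ _ _
    rw [← tsum_eq_finsum (L := SummationFilter.unconditional _) hs]
    refine tsum_congr fun α => ?_
    rw [lamOp_single, Cc.star_apply, inv_div]
    simp [mul_comm]

theorem lam_apply (x : UnitSpace G) (f : Cc G) : lam x f = lamOp x f := rfl

variable (G) in
/-- A C*-norm on the `*`-algebra `C_c(G)`. -/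
structure CStarNorm extends Seminorm ℂ (Cc G) where
  eq_zero_of_map_eq_zero' : ∀ f, toFun f = 0 → f = 0
  map_mul_le' : ∀ f g, toFun (f * g) ≤ toFun f * toFun g
  map_star_mul_self' : ∀ f, toFun (star f * f) = toFun f ^ 2

/-- The C*-norm `f ↦ sup_i ‖π_i(f)‖` of a separating family of `*`-representations which are
contractive for `‖·‖_I`. -/
noncomputable def supNorm {ι : Type*} (H : ι → Type u) [∀ i, NormedAddCommGroup (H i)]
    [∀ i, InnerProductSpace ℂ (H i)] [∀ i, CompleteSpace (H i)]
    (π : ∀ i, Cc G →⋆ₙₐ[ℂ] (H i →L[ℂ] H i)) (hπ : ∀ i f, ‖π i f‖ ≤ iNorm f)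
    (hsep : ∀ f, (∀ i, π i f = 0) → f = 0) : CStarNorm G :=
  have hb : ∀ f, BddAbove (range fun i => ‖π i f‖) := fun f =>
    ⟨iNorm f, by rintro _ ⟨i, rfl⟩; exact hπ i f⟩
  have hn : ∀ f, 0 ≤ ⨆ i, ‖π i f‖ := fun f => Real.iSup_nonneg fun _ => norm_nonneg _
  { toFun := fun f => ⨆ i, ‖π i f‖
    map_zero' := by simp
    add_le' := fun f g => Real.iSup_le (fun i => by
      rw [map_add]
      exact (norm_add_le _ _).trans (add_le_add (le_ciSup (hb f) i) (le_ciSup (hb g) i)))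
      (add_nonneg (hn f) (hn g))
    neg' := fun f => by simp
    smul' := fun c f => by
      simp only [map_smul, norm_smul]
      rw [Real.mul_iSup_of_nonneg (norm_nonneg c)]
    eq_zero_of_map_eq_zero' := fun f hf => hsep f fun i =>
      norm_le_zero_iff.1 ((le_ciSup (hb f) i).trans hf.le)
    map_mul_le' := fun f g => Real.iSup_le (fun i => by
      rw [map_mul]
      exact (norm_mul_le _ _).trans (mul_le_mul (le_ciSup (hb f) i) (le_ciSup (hb g) i)
        (norm_nonneg _) (hn f))) (mul_nonneg (hn f) (hn g))
    map_star_mul_self' := fun f => by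
      have h : ∀ i, ‖π i (star f * f)‖ = ‖π i f‖ ^ 2 := fun i => by
        rw [map_mul, map_star, CStarRing.norm_star_mul_self, sq]
      apply le_antisymm
      · refine Real.iSup_le (fun i => ?_) (sq_nonneg _)
        rw [h]
        exact pow_le_pow_left₀ (norm_nonneg _) (le_ciSup (hb f) i) 2
      · refine (Real.le_sqrt (hn f) (hn (star f * f))).1 (Real.iSup_le (fun i => ?_)
          (Real.sqrt_nonneg _))
        refine Real.le_sqrt_of_sq_le ?_
        rw [← h]
        exact le_ciSup (hb (star f * f)) i }

theorem eq_zero_of_lam (f : Cc G) (h : ∀ x, lam x f = 0) : f = 0 := by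
  classical
  ext γ
  have h1 := lamOp_single (src γ) f (unitFiber (src γ)) ⟨γ, rfl⟩
  rw [div_unit, ← lam_apply, h] at h1
  rw [← h1]; rfl

variable (G) in
/-- The reduced C*-norm `‖f‖_r = sup_x ‖λ_x(f)‖`. -/
noncomputable def reducedNorm : CStarNorm G :=
  supNorm (fun x : UnitSpace G => FiberL2 x) lam norm_lamOp_le eq_zero_of_lam

variable (G) in
/-- A `*`-representation of `C_c(G)` on a Hilbert space which is contractive for `‖·‖_I`
(equivalently, by unique extension, a contractive `*`-representation of the completion
`L¹(G)` of `C_c(G)` for `‖·‖_I`). -/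
structure ContractiveRep where
  /-- the Hilbert space -/
  H : Type u
  [normed : NormedAddCommGroup H]
  [inner : InnerProductSpace ℂ H]
  [complete : CompleteSpace H]
  /-- the representation -/
  π : Cc G →⋆ₙₐ[ℂ] (H →L[ℂ] H)
  contractive : ∀ f, ‖π f‖ ≤ iNorm f

attribute [instance] ContractiveRep.normed ContractiveRep.inner ContractiveRep.complete

/-- The left regular representations are contractive for `‖·‖_I`. -/
noncomputable def lamRep (x : UnitSpace G) : ContractiveRep G where
  H := FiberL2 x
  π := lam x
  contractive := norm_lamOp_le x

variable (G) in
/-- The maximal C*-norm `‖f‖_max = sup ‖π(f)‖` over all `*`-representations contractive for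
`‖·‖_I`. -/
noncomputable def maxNorm : CStarNorm G :=
  supNorm (fun ρ : ContractiveRep G => ρ.H) (fun ρ => ρ.π) (fun ρ => ρ.contractive)
    fun f hf => eq_zero_of_lam f fun x => hf (lamRep x)

/-- The C*-norm `N` dominates the reduced C*-norm. -/
def CStarNorm.DominatesReduced (N : CStarNorm G) : Prop :=
  ∀ f : Cc G, (reducedNorm G).toSeminorm f ≤ N.toSeminorm f

theorem maxNorm_dominatesReduced : (maxNorm G).DominatesReduced := fun f =>
  Real.iSup_le (fun x => le_ciSup (f := fun ρ : ContractiveRep G => ‖ρ.π f‖)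
    ⟨iNorm f, by rintro _ ⟨ρ, rfl⟩; exact ρ.contractive f⟩ (lamRep x))
    (Real.iSup_nonneg fun _ => norm_nonneg _)

end Norms

section Completion

open UniformSpace Topology

variable {G : Type u} [TopologicalSpace G] [TopGpd G] [IsEtale G] [LocallyCompactSpace G]
  [T2Space G]

/-- The `*`-algebra `C_c(G)` normed by the C*-norm `N`. -/
def NormedCc (_N : CStarNorm G) : Type u := Cc G

section NormedCc

variable (N : CStarNorm G)

noncomputable instance : NonUnitalRing (NormedCc N) := inferInstanceAs (NonUnitalRing (Cc G))
noncomputable instance : Module ℂ (NormedCc N) := inferInstanceAs (Module ℂ (Cc G))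
noncomputable instance : StarRing (NormedCc N) := inferInstanceAs (StarRing (Cc G))
instance : IsScalarTower ℂ (NormedCc N) (NormedCc N) :=
  inferInstanceAs (IsScalarTower ℂ (Cc G) (Cc G))
instance : SMulCommClass ℂ (NormedCc N) (NormedCc N) :=
  inferInstanceAs (SMulCommClass ℂ (Cc G) (Cc G))
instance : StarModule ℂ (NormedCc N) := inferInstanceAs (StarModule ℂ (Cc G))

/-- The linear identification of `C_c(G)` with its normed copy. -/
noncomputable def toNormed : Cc G ≃ₗ[ℂ] NormedCc N := LinearEquiv.refl ℂ (Cc G)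

noncomputable instance : NormedAddCommGroup (NormedCc N) :=
  AddGroupNorm.toNormedAddCommGroup
    { toFun := fun f : NormedCc N => N.toSeminorm ((toNormed N).symm f)
      map_zero' := by simp
      add_le' := fun f g => by rw [map_add]; exact map_add_le_add _ _ _
      neg' := fun f => by rw [map_neg]; exact map_neg_eq_map _ _
      eq_zero_of_map_eq_zero' := fun f hf => N.eq_zero_of_map_eq_zero' f hf }

theorem norm_toNormed (f : Cc G) : ‖toNormed N f‖ = N.toSeminorm f := rfl

noncomputable instance : NonUnitalNormedRing (NormedCc N) where
  __ := (inferInstance : NormedAddCommGroup (NormedCc N))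
  __ := (inferInstance : NonUnitalRing (NormedCc N))
  norm_mul_le f g := N.map_mul_le' f g

noncomputable instance : NormedSpace ℂ (NormedCc N) where
  norm_smul_le c f := (map_smul_eq_mul N.toSeminorm c f).le

instance : CStarRing (NormedCc N) where
  norm_mul_self_le f := by
    have : ‖star f * f‖ = ‖f‖ ^ 2 := N.map_star_mul_self' f
    rw [this, sq]

end NormedCc

/-- The groupoid C*-algebra `C*_N(G)`, the completion of `C_c(G)` for the C*-norm `N`. -/
def GroupoidCStar (N : CStarNorm G) : Type u := Completion (NormedCc N)

namespace GroupoidCStar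

variable (N : CStarNorm G)

noncomputable instance : NormedAddCommGroup (GroupoidCStar N) :=
  inferInstanceAs (NormedAddCommGroup (Completion (NormedCc N)))
noncomputable instance : NormedSpace ℂ (GroupoidCStar N) :=
  inferInstanceAs (NormedSpace ℂ (Completion (NormedCc N)))
instance : CompleteSpace (GroupoidCStar N) :=
  inferInstanceAs (CompleteSpace (Completion (NormedCc N)))

/-- The inclusion `C_c(G) → C*_N(G)` as an isometry on the normed copy of `C_c(G)`. -/
noncomputable def coeL : NormedCc N →L[ℂ] GroupoidCStar N :=
  (Completion.toComplL : NormedCc N →L[ℂ] Completion (NormedCc N))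

theorem norm_coeL (f : NormedCc N) : ‖coeL N f‖ = ‖f‖ := Completion.norm_coe f

theorem denseRange_coeL : DenseRange (coeL N) := Completion.denseRange_coe

theorem isUniformInducing_coeL : IsUniformInducing (coeL N) :=
  Completion.isUniformInducing_coe _

theorem isDenseInducing_coeL : IsDenseInducing (coeL N) := Completion.isDenseInducing_coe

/-- The product, extended by continuity. -/
noncomputable instance : Mul (GroupoidCStar N) where
  mul a b := ((isDenseInducing_coeL N).prodMap (isDenseInducing_coeL N)).extend
    (fun p : NormedCc N × NormedCc N => coeL N (p.1 * p.2)) (a, b)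

/-- The involution, extended by continuity. -/
noncomputable instance : Star (GroupoidCStar N) where
  star := (isDenseInducing_coeL N).extend fun f => coeL N (star f)

theorem coeL_mul (f g : NormedCc N) : coeL N (f * g) = coeL N f * coeL N g :=
  (((isDenseInducing_coeL N).prodMap (isDenseInducing_coeL N)).extend_eq
    (f := fun p : NormedCc N × NormedCc N => coeL N (p.1 * p.2))
    ((coeL N).continuous.comp continuous_mul) (f, g)).symm

theorem continuous_mul' : Continuous fun p : GroupoidCStar N × GroupoidCStar N => p.1 * p.2 := by
  let m := (AddMonoidHom.mul : NormedCc N →+ NormedCc N →+ NormedCc N).compr₂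
    (coeL N).toLinearMap.toAddMonoidHom
  have h : Continuous fun p : NormedCc N × NormedCc N => m p.1 p.2 :=
    (coeL N).continuous.comp continuous_mul
  have di : IsDenseInducing ((coeL N).toLinearMap.toAddMonoidHom) := isDenseInducing_coeL N
  exact (di.extend_Z_bilin di h :)

theorem coeL_star (f : NormedCc N) : coeL N (star f) = star (coeL N f) :=
  ((isDenseInducing_coeL N).extend_eq (f := fun f => coeL N (star f))
    ((coeL N).continuous.comp continuous_star) f).symm

theorem continuous_star' : Continuous fun a : GroupoidCStar N => star a := by
  have h : UniformContinuous fun f : NormedCc N => coeL N (star f) :=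
    (coeL N).uniformContinuous.comp (starₗᵢ ℂ : NormedCc N ≃ₗᵢ⋆[ℂ] NormedCc N).isometry.uniformContinuous
  exact (uniformContinuous_uniformly_extend (isUniformInducing_coeL N) (denseRange_coeL N)
    h).continuous

variable {N} in
theorem ind {p : GroupoidCStar N → Prop} (a : GroupoidCStar N) (hc : IsClosed {a | p a})
    (h : ∀ f : NormedCc N, p (coeL N f)) : p a :=
  (denseRange_coeL N).induction_on a hc h

instance : ContinuousMul (GroupoidCStar N) := ⟨continuous_mul' N⟩
instance : ContinuousStar (GroupoidCStar N) := ⟨continuous_star' N⟩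
instance : ContinuousConstSMul ℂ (GroupoidCStar N) := inferInstance

theorem continuous_smul_left (c : ℂ) : Continuous fun a : GroupoidCStar N => c • a :=
  continuous_const_smul c

variable {N} in
theorem ind₂ {p : GroupoidCStar N → GroupoidCStar N → Prop} (a b : GroupoidCStar N)
    (hc : IsClosed {x : GroupoidCStar N × GroupoidCStar N | p x.1 x.2})
    (h : ∀ f g : NormedCc N, p (coeL N f) (coeL N g)) : p a b :=
  ((denseRange_coeL N).prodMap (denseRange_coeL N)).induction_on
    (p := fun x : GroupoidCStar N × GroupoidCStar N => p x.1 x.2) (a, b) hc fun q => h q.1 q.2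

variable {N} in
theorem ind₃ {p : GroupoidCStar N → GroupoidCStar N → GroupoidCStar N → Prop}
    (a b c : GroupoidCStar N)
    (hc : IsClosed {x : GroupoidCStar N × GroupoidCStar N × GroupoidCStar N | p x.1 x.2.1 x.2.2})
    (h : ∀ f g k : NormedCc N, p (coeL N f) (coeL N g) (coeL N k)) : p a b c :=
  ((denseRange_coeL N).prodMap ((denseRange_coeL N).prodMap (denseRange_coeL N))).induction_on
    (p := fun x : GroupoidCStar N × GroupoidCStar N × GroupoidCStar N => p x.1 x.2.1 x.2.2)
    (a, b, c) hc fun q => h q.1 q.2.1 q.2.2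

theorem zero_mul' (a : GroupoidCStar N) : 0 * a = 0 := by
  induction a using ind with
  | hc => exact isClosed_eq (by fun_prop) (by fun_prop)
  | h f =>
    rw [← map_zero (coeL N), ← coeL_mul, zero_mul]

theorem mul_zero' (a : GroupoidCStar N) : a * 0 = 0 := by
  induction a using ind with
  | hc => exact isClosed_eq (by fun_prop) (by fun_prop)
  | h f =>
    rw [← map_zero (coeL N), ← coeL_mul, mul_zero]

theorem mul_add' (a b c : GroupoidCStar N) : a * (b + c) = a * b + a * c := by
  induction a, b, c using ind₃ with
  | hc => exact isClosed_eq (by fun_prop) (by fun_prop)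
  | h f g h =>
    rw [← map_add, ← coeL_mul, ← coeL_mul, ← coeL_mul, ← map_add, mul_add]

theorem add_mul' (a b c : GroupoidCStar N) : (a + b) * c = a * c + b * c := by
  induction a, b, c using ind₃ with
  | hc => exact isClosed_eq (by fun_prop) (by fun_prop)
  | h f g h =>
    rw [← map_add, ← coeL_mul, ← coeL_mul, ← coeL_mul, ← map_add, add_mul]

theorem mul_assoc' (a b c : GroupoidCStar N) : a * b * c = a * (b * c) := by
  induction a, b, c using ind₃ with
  | hc => exact isClosed_eq (by fun_prop) (by fun_prop)
  | h f g h =>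
    rw [← coeL_mul, ← coeL_mul, ← coeL_mul, ← coeL_mul, mul_assoc]

theorem star_star' (a : GroupoidCStar N) : star (star a) = a := by
  induction a using ind with
  | hc => exact isClosed_eq (by fun_prop) (by fun_prop)
  | h f =>
    rw [← coeL_star, ← coeL_star, star_star]

theorem star_mul' (a b : GroupoidCStar N) : star (a * b) = star b * star a := by
  induction a, b using ind₂ with
  | hc => exact isClosed_eq (by fun_prop) (by fun_prop)
  | h f g =>
    rw [← coeL_mul, ← coeL_star, ← coeL_star, ← coeL_star, ← coeL_mul, star_mul]

theorem star_add' (a b : GroupoidCStar N) : star (a + b) = star a + star b := by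
  induction a, b using ind₂ with
  | hc => exact isClosed_eq (by fun_prop) (by fun_prop)
  | h f g =>
    rw [← map_add, ← coeL_star, ← coeL_star, ← coeL_star, ← map_add, star_add]

theorem norm_mul_le' (a b : GroupoidCStar N) : ‖a * b‖ ≤ ‖a‖ * ‖b‖ := by
  induction a, b using ind₂ with
  | hc => exact isClosed_le (by fun_prop) (by fun_prop)
  | h f g =>
    rw [← coeL_mul, norm_coeL, norm_coeL, norm_coeL]
    exact norm_mul_le f g

theorem norm_mul_self_le' (a : GroupoidCStar N) : ‖a‖ * ‖a‖ ≤ ‖star a * a‖ := by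
  induction a using ind with
  | hc => exact isClosed_le (by fun_prop) (by fun_prop)
  | h f =>
    rw [← coeL_star, ← coeL_mul, norm_coeL, norm_coeL]
    exact CStarRing.norm_mul_self_le f

theorem smul_mul' (c : ℂ) (a b : GroupoidCStar N) : (c • a) * b = c • (a * b) := by
  induction a, b using ind₂ with
  | hc => exact isClosed_eq (((continuous_smul_left N c).comp continuous_fst).mul continuous_snd)
            ((continuous_smul_left N c).comp (continuous_fst.mul continuous_snd))
  | h f g =>
    rw [← map_smul, ← coeL_mul, ← coeL_mul, ← map_smul, smul_mul_assoc]

theorem mul_smul' (c : ℂ) (a b : GroupoidCStar N) : a * (c • b) = c • (a * b) := by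
  induction a, b using ind₂ with
  | hc => exact isClosed_eq (continuous_fst.mul ((continuous_smul_left N c).comp continuous_snd))
            ((continuous_smul_left N c).comp (continuous_fst.mul continuous_snd))
  | h f g =>
    rw [← map_smul, ← coeL_mul, ← coeL_mul, ← map_smul, mul_smul_comm]

theorem star_smul' (c : ℂ) (a : GroupoidCStar N) : star (c • a) = star c • star a := by
  induction a using ind with
  | hc => exact isClosed_eq (continuous_star.comp (continuous_smul_left N c))
            ((continuous_smul_left N (star c)).comp continuous_star)
  | h f =>
    rw [← map_smul, ← coeL_star, ← coeL_star, ← map_smul, star_smul]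

noncomputable instance : NonUnitalNormedRing (GroupoidCStar N) where
  __ := (inferInstance : NormedAddCommGroup (GroupoidCStar N))
  zero_mul := zero_mul' N
  mul_zero := mul_zero' N
  left_distrib := mul_add' N
  right_distrib := add_mul' N
  mul_assoc := mul_assoc' N
  norm_mul_le := norm_mul_le' N

noncomputable instance : StarRing (GroupoidCStar N) where
  star_involutive := star_star' N
  star_mul := star_mul' N
  star_add := star_add' N

noncomputable instance : NonUnitalCStarAlgebra (GroupoidCStar N) where
  norm_mul_self_le := norm_mul_self_le' N
  smul_assoc := smul_mul' N
  smul_comm c a b := (mul_smul' N c a b).symm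
  star_smul := star_smul' N

/-- The inclusion `C_c(G) → C*_N(G)`. -/
noncomputable def ofCc : Cc G →⋆ₙₐ[ℂ] GroupoidCStar N where
  toFun f := coeL N (toNormed N f)
  map_smul' c f := by simp
  map_zero' := by simp
  map_add' f g := by simp
  map_mul' f g := coeL_mul N f g
  map_star' f := coeL_star N f

end GroupoidCStar

/-- The canonical map `q_N : C*_N(G) → C*_r(G)`, the continuous extension of the identity of
`C_c(G)`, for a C*-norm `N` dominating the reduced C*-norm. -/
noncomputable def quotientMap {N : CStarNorm G} (hN : N.DominatesReduced) :
    GroupoidCStar N →L[ℂ] GroupoidCStar (reducedNorm G) :=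
  ContinuousLinearMap.completion
    (LinearMap.mkContinuous
      ((toNormed N).symm.trans (toNormed (reducedNorm G)) :
        NormedCc N →ₗ[ℂ] NormedCc (reducedNorm G)) 1
      fun f => by rw [one_mul]; exact hN f)

theorem norm_lam_le (x : UnitSpace G) (f : Cc G) :
    ‖lam x f‖ ≤ (reducedNorm G).toSeminorm f :=
  le_ciSup (f := fun x : UnitSpace G => ‖lam x f‖)
    ⟨iNorm f, by rintro _ ⟨x, rfl⟩; exact norm_lamOp_le x f⟩ x

/-- The extension of the left regular representation `λ_x` to `C*_r(G)`. -/
noncomputable def lamExt (x : UnitSpace G) :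
    GroupoidCStar (reducedNorm G) →L[ℂ] (FiberL2 x →L[ℂ] FiberL2 x) :=
  ContinuousLinearMap.fromCompletion
    (LinearMap.mkContinuous
      ({ toFun := fun f => lam x ((toNormed (reducedNorm G)).symm f)
         map_add' := fun f g => by simp
         map_smul' := fun c f => by simp } :
        NormedCc (reducedNorm G) →ₗ[ℂ] (FiberL2 x →L[ℂ] FiberL2 x)) 1
      fun f => by rw [one_mul]; exact norm_lam_le x _)

open Classical in
/-- The canonical conditional expectation `E` on `C*_r(G)`:
`E(a)(u) = ⟨λ_u(a) δ_u, δ_u⟩`, as a function on the unit space (Mathlib's inner product is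
linear in the second variable). -/
noncomputable def condExpUnits (a : GroupoidCStar (reducedNorm G)) (u : UnitSpace G) : ℂ :=
  inner ℂ (lp.single 2 (unitFiber u) 1 : FiberL2 u) (lamExt u a (lp.single 2 (unitFiber u) 1))

theorem quotientMap_ofCc {N : CStarNorm G} (hN : N.DominatesReduced) (f : Cc G) :
    quotientMap hN (GroupoidCStar.ofCc N f) = GroupoidCStar.ofCc (reducedNorm G) f :=
  ContinuousLinearMap.completion_apply_coe _ _

theorem condExpUnits_ofCc (f : Cc G) (u : UnitSpace G) :
    condExpUnits (GroupoidCStar.ofCc (reducedNorm G) f) u = f (u : G) := by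
  classical
  have h : lamExt u (GroupoidCStar.ofCc (reducedNorm G) f) = lam u f :=
    ContinuousLinearMap.fromCompletion_apply_coe _ _
  rw [condExpUnits, h, lp.inner_single_left, lam_apply, lamOp_single, div_unit]
  simp [unitFiber]

end Completion

section Measure

open Set Topology MeasureTheory

set_option linter.unusedSectionVars false

variable {G : Type u} [TopologicalSpace G] [TopGpd G]

/-- For a bisection `B` and `x ∈ s(B)`, the element `(s|_B)⁻¹(x)` of `B` with source `x`. -/
noncomputable def bisectionSection (B : Set G) (x : ↥(src '' B : Set (UnitSpace G))) : G :=
  Classical.choose x.2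

theorem bisectionSection_mem (B : Set G) (x : ↥(src '' B : Set (UnitSpace G))) :
    bisectionSection B x ∈ B := (Classical.choose_spec x.2).1

theorem src_bisectionSection (B : Set G) (x : ↥(src '' B : Set (UnitSpace G))) :
    src (bisectionSection B x) = x := (Classical.choose_spec x.2).2

/-- The map `α_B : s(B) → r(B)`, `α_B(x) = r((s|_B)⁻¹(x))`, of a bisection `B`. -/
noncomputable def bisectionMap (B : Set G) (x : ↥(src '' B : Set (UnitSpace G))) :
    ↥(rng '' B : Set (UnitSpace G)) :=
  ⟨rng (bisectionSection B x), mem_image_of_mem _ (bisectionSection_mem B x)⟩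

/-- The fixed point set `Fix(α_B) = {x ∈ s(B) : α_B(x) = x}`. -/
def fixSet (B : Set G) : Set (UnitSpace G) :=
  {x | ∃ h : x ∈ (src '' B : Set (UnitSpace G)), (bisectionMap B ⟨x, h⟩ : UnitSpace G) = x}

open Classical in
/-- The function `g_B = g ∘ (s|_B)⁻¹` on `s(B)`, extended by zero. -/
noncomputable def pullSource (B : Set G) (g : Cc G) (x : UnitSpace G) : ℂ :=
  if h : x ∈ (src '' B : Set (UnitSpace G)) then g (bisectionSection B ⟨x, h⟩) else 0

variable [MeasurableSpace (UnitSpace G)]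

/-- A measure on the unit space is invariant if `μ|_{r(B)} = (α_B)_* (μ|_{s(B)})` for every open
bisection `B`. -/
def IsInvariant (μ : Measure (UnitSpace G)) : Prop :=
  ∀ B : Set G, IsOpen B → IsBisection B →
    μ.comap (Subtype.val : ↥(rng '' B : Set (UnitSpace G)) → UnitSpace G) =
      (μ.comap (Subtype.val : ↥(src '' B : Set (UnitSpace G)) → UnitSpace G)).map (bisectionMap B)

/-- Essential freeness with respect to `μ`: the set `Fix(α_B)` is null for every pre-compact open
bisection `B` not meeting the unit space. -/
def IsEssentiallyFree (μ : Measure (UnitSpace G)) : Prop :=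
  ∀ B : Set G, IsPrecompactOpenBisection B → B ⊆ (units : Set G)ᶜ → μ (fixSet B) = 0

variable [IsEtale G] [LocallyCompactSpace G] [T2Space G] [BorelSpace (UnitSpace G)]

theorem IsPrecompactOpenBisection.section_eq {B : Set G} (hB : IsPrecompactOpenBisection B) {γ : G}
    (hγ : γ ∈ B) (h : src γ ∈ (src '' B : Set (UnitSpace G))) :
    bisectionSection B ⟨src γ, h⟩ = γ :=
  hB.isBisection.src_injOn (bisectionSection_mem B _) hγ (src_bisectionSection B _)

theorem IsPrecompactOpenBisection.mem_fixSet {B : Set G} (hB : IsPrecompactOpenBisection B)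
    {γ : G} (hγ : γ ∈ B) : src γ ∈ fixSet B ↔ rng γ = src γ := by
  have h : src γ ∈ (src '' B : Set (UnitSpace G)) := mem_image_of_mem _ hγ
  constructor
  · rintro ⟨h', e⟩
    rw [bisectionMap] at e
    simpa [hB.section_eq hγ h'] using e
  · intro e
    refine ⟨h, ?_⟩
    simpa [bisectionMap, hB.section_eq hγ h] using e

theorem fixSet_subset (B : Set G) : fixSet B ⊆ src '' B := fun _ ⟨h, _⟩ => h

theorem isOpen_src_image {U : Set G} (hU : IsOpen U) : IsOpen (src '' U : Set (UnitSpace G)) :=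
  isLocalHomeomorph_src.isOpenMap U hU

theorem IsPrecompactOpenBisection.measurableSet_fixSet {B : Set G}
    (hB : IsPrecompactOpenBisection B) : MeasurableSet (fixSet B) := by
  have hO : IsOpen (B ∩ {γ : G | rng γ ≠ src γ}) :=
    hB.isOpen.inter (isOpen_ne_fun TopGpd.continuous_rng TopGpd.continuous_src)
  have : fixSet B = (src '' B) \ (src '' (B ∩ {γ : G | rng γ ≠ src γ})) := by
    ext x
    constructor
    · intro hx
      refine ⟨fixSet_subset B hx, ?_⟩
      rintro ⟨γ, ⟨hγ, hne⟩, rfl⟩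
      exact hne ((hB.mem_fixSet hγ).1 hx)
    · rintro ⟨⟨γ, hγ, rfl⟩, h2⟩
      rw [hB.mem_fixSet hγ]
      by_contra h
      exact h2 ⟨γ, ⟨hγ, h⟩, rfl⟩
  rw [this]
  exact (isOpen_src_image hB.isOpen).measurableSet.diff (isOpen_src_image hO).measurableSet

theorem IsPrecompactOpenBisection.measurable_pullSource {B : Set G}
    (hB : IsPrecompactOpenBisection B) (g : Cc G) : Measurable (pullSource B g) := by
  classical
  have hc : Continuous (bisectionSection B) := by
    let e := hB.isBisection.1.toHomeomorph
    have hr : ∀ x : ↥(src '' B : Set (UnitSpace G)),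
        x.1 ∈ range (B.domRestrict (src : G → UnitSpace G)) := fun x => by
      obtain ⟨γ, hγ, h⟩ := x.2
      exact ⟨⟨γ, hγ⟩, h⟩
    have : bisectionSection B = fun x => (e.symm ⟨x.1, hr x⟩ : B).1 := by
      funext x
      refine hB.isBisection.src_injOn (bisectionSection_mem B x) (Subtype.coe_prop _) ?_
      rw [src_bisectionSection]
      exact (congrArg Subtype.val (e.apply_symm_apply ⟨x.1, hr x⟩)).symm
    rw [this]
    exact continuous_subtype_val.comp (e.symm.continuous.comp
      (continuous_subtype_val.subtype_mk _))
  exact Measurable.dite (s := (src '' B : Set (UnitSpace G)))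
    (f := fun x => g (bisectionSection B x)) (g := fun _ => 0)
    (g.continuous.comp hc).measurable measurable_const (isOpen_src_image hB.isOpen).measurableSet

open Classical in
/-- The sum of `g` over the isotropy group at `x`. -/
noncomputable def isotropySum (g : Cc G) (x : UnitSpace G) : ℂ :=
  ∑ᶠ γ : Fiber x, if rng γ.1 = x then g γ.1 else 0

theorem isotropySum_add (f g : Cc G) (x : UnitSpace G) :
    isotropySum (f + g) x = isotropySum f x + isotropySum g x := by
  unfold isotropySum
  rw [← finsum_add_distrib]
  · refine finsum_congr fun γ => ?_
    split_ifs <;> simp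
  · exact (f.finite_fiber x).subset fun γ hγ => by
      simp only [Function.mem_support, ne_eq, ite_eq_right_iff, Classical.not_imp] at hγ
      exact hγ.2
  · exact (g.finite_fiber x).subset fun γ hγ => by
      simp only [Function.mem_support, ne_eq, ite_eq_right_iff, Classical.not_imp] at hγ
      exact hγ.2

theorem isotropySum_smul (c : ℂ) (f : Cc G) (x : UnitSpace G) :
    isotropySum (c • f) x = c * isotropySum f x := by
  unfold isotropySum
  refine Eq.trans (finsum_congr fun γ => ?_) (smul_finsum c _).symm
  split_ifs <;> simp

theorem IsPrecompactOpenBisection.isotropySum_eq {B : Set G} (hB : IsPrecompactOpenBisection B)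
    {g : Cc G} (hg : tsupport g ⊆ B) : isotropySum g = (fixSet B).indicator (pullSource B g) := by
  classical
  funext x
  by_cases hx : x ∈ (src '' B : Set (UnitSpace G))
  · obtain ⟨γ, hγ, rfl⟩ := hx
    have h1 : isotropySum g (src γ) = if rng γ = src γ then g γ else 0 := by
      refine (finsum_eq_single _ (⟨γ, rfl⟩ : Fiber (src γ)) fun δ hδ => ?_).trans (by congr)
      have : g δ.1 = 0 := by
        by_contra h
        exact hδ (Subtype.ext (hB.isBisection.src_injOn (hg (subset_tsupport _ h)) hγ δ.2))
      simp [this]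
    have h2 : pullSource B g (src γ) = g γ := by
      have h : src γ ∈ (src '' B : Set (UnitSpace G)) := mem_image_of_mem _ hγ
      rw [pullSource, dif_pos h, hB.section_eq hγ h]
    rw [h1, indicator_apply, h2]
    simp only [hB.mem_fixSet hγ]
  · rw [indicator_of_notMem fun h => hx (fixSet_subset B h)]
    refine finsum_eq_zero_of_forall_eq_zero fun δ => ?_
    have : g δ.1 = 0 := by
      by_contra h
      exact hx ⟨δ.1, hg (subset_tsupport _ h), δ.2⟩
    simp [this]

theorem integrable_isotropySum (μ : Measure (UnitSpace G)) [IsFiniteMeasure μ] (g : Cc G) :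
    Integrable (isotropySum g) μ := by
  induction g using Cc.induction with
  | h0 =>
    have : isotropySum (0 : Cc G) = fun _ => 0 := by
      funext x; simp [isotropySum]
    rw [this]; exact integrable_const 0
  | hadd f g hf hg =>
    have : isotropySum (f + g) = fun x => isotropySum f x + isotropySum g x :=
      funext (isotropySum_add f g)
    rw [this]; exact hf.add hg
  | hB B g hB hg =>
    rw [hB.isotropySum_eq hg]
    obtain ⟨C, hC0, hC⟩ := g.exists_bound
    refine (Integrable.of_bound (hB.measurable_pullSource g).aestronglyMeasurable C
      (Filter.Eventually.of_forall fun x => ?_)).indicator hB.measurableSet_fixSet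
    unfold pullSource
    split_ifs
    · exact hC _
    · simpa using hC0

/-- There is exactly one linear functional on `C_c(G)` given by `g ↦ ∫_{Fix(α_B)} g_B dμ` on the
functions `g` supported in a pre-compact open bisection `B`. -/
theorem existsUnique_fixedPointTrace (μ : Measure (UnitSpace G)) [IsFiniteMeasure μ] :
    ∃! φ : Cc G →ₗ[ℂ] ℂ, ∀ (B : Set G) (g : Cc G), IsPrecompactOpenBisection B →
      tsupport g ⊆ B → φ g = ∫ x in fixSet B, pullSource B g x ∂μ := by
  refine ⟨{ toFun := fun g => ∫ x, isotropySum g x ∂μ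
            map_add' := fun f g => ?_
            map_smul' := fun c f => ?_ }, fun B g hB hg => ?_, fun ψ hψ => ?_⟩
  · simp only [isotropySum_add]
    exact integral_add (integrable_isotropySum μ f) (integrable_isotropySum μ g)
  · simp only [isotropySum_smul]
    exact integral_const_mul c _
  · simp only [LinearMap.coe_mk, AddHom.coe_mk]
    rw [hB.isotropySum_eq hg, integral_indicator hB.measurableSet_fixSet]
  · ext g
    induction g using Cc.induction with
    | h0 => exact (map_zero _).trans (map_zero (_ : Cc G →ₗ[ℂ] ℂ)).symm
    | hadd f g hf hg => rw [map_add, map_add, hf, hg]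
    | hB B g hB hg =>
      rw [hψ B g hB hg]
      simp only [LinearMap.coe_mk, AddHom.coe_mk]
      rw [hB.isotropySum_eq hg, integral_indicator hB.measurableSet_fixSet]

/-- The fixed point trace `τ^Fix_μ : C_c(G) → ℂ`: the linear functional with
`τ^Fix_μ(∑ g_i) = ∑ ∫_{Fix(α_{B_i})} (g_i)_{B_i} dμ` whenever `g_i` is supported in a pre-compact
open bisection `B_i`. -/
noncomputable def fixedPointTrace (μ : Measure (UnitSpace G)) [IsFiniteMeasure μ] :
    Cc G →ₗ[ℂ] ℂ := (existsUnique_fixedPointTrace μ).choose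

theorem fixedPointTrace_apply (μ : Measure (UnitSpace G)) [IsFiniteMeasure μ] {B : Set G}
    {g : Cc G} (hB : IsPrecompactOpenBisection B) (hg : tsupport g ⊆ B) :
    fixedPointTrace μ g = ∫ x in fixSet B, pullSource B g x ∂μ :=
  (existsUnique_fixedPointTrace μ).choose_spec.1 B g hB hg

end Measure

section Trace

open Set Topology MeasureTheory

open scoped ComplexOrder in
/-- A tracial state on a C*-algebra `A`: a positive linear functional of norm one with
`τ(ab) = τ(ba)`. -/
structure IsTracialState {A : Type*} [NonUnitalCStarAlgebra A] (τ : A →L[ℂ] ℂ) : Prop where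
  nonneg : ∀ a, 0 ≤ τ (star a * a)
  norm_eq_one : ‖τ‖ = 1
  trace : ∀ a b, τ (a * b) = τ (b * a)

variable {G : Type u} [TopologicalSpace G] [TopGpd G] [IsEtale G] [LocallyCompactSpace G]
  [T2Space G]

open Classical in
/-- The inclusion `C_c(G⁰) → C_c(G)`, extension by zero. -/
noncomputable def extendZero (f : Cc (UnitSpace G)) : Cc G :=
  Cc.mk (fun γ => if h : γ ∈ (units : Set G) then f ⟨γ, h⟩ else 0)
    (by
      have hcl : IsClosed (units : Set G) := by
        have : (units : Set G) = {γ | ((src γ : UnitSpace G) : G) = γ} := by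
          ext γ
          exact ⟨fun h => congrArg Subtype.val (src_unit ⟨γ, h⟩), fun h => h ▸ (src γ).2⟩
        rw [this]
        exact isClosed_eq (continuous_subtype_val.comp TopGpd.continuous_src) continuous_id
      rw [continuous_iff_continuousAt]
      intro γ
      by_cases h : γ ∈ (units : Set G)
      · refine ContinuousOn.continuousAt ?_ (isOpen_units.mem_nhds h)
        rw [continuousOn_iff_continuous_domRestrict]
        refine f.continuous.congr fun x => ?_
        simp [domRestrict_apply]
      · refine continuousAt_const.congr (f := fun _ => (0 : ℂ)) ?_
        filter_upwards [hcl.isOpen_compl.mem_nhds h] with δ hδ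
        rw [dif_neg hδ])
    (HasCompactSupport.intro (f.hasCompactSupport.isCompact.image continuous_subtype_val)
      fun γ hγ => by
        split_ifs with h
        · by_contra h0
          exact hγ ⟨⟨γ, h⟩, subset_tsupport _ h0, rfl⟩
        · rfl)

theorem extendZero_unit (f : Cc (UnitSpace G)) (x : UnitSpace G) : extendZero f (x : G) = f x := by
  simp [extendZero]

theorem extendZero_of_notMem (f : Cc (UnitSpace G)) {γ : G} (h : γ ∉ (units : Set G)) :
    extendZero f γ = 0 := by
  simp [extendZero, h]

variable [MeasurableSpace (UnitSpace G)]

/-- The measure `μ` represents the restriction of the functional `τ` on `C*_N(G)` to functions on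
the unit space: `τ(f) = ∫ f dμ` for all `f ∈ C_c(G⁰)` (a dense subset of `C_0(G⁰)`). -/
def IsAssociatedMeasure {N : CStarNorm G} (τ : GroupoidCStar N →L[ℂ] ℂ)
    (μ : Measure (UnitSpace G)) : Prop :=
  ∀ f : Cc (UnitSpace G), τ (GroupoidCStar.ofCc N (extendZero f)) = ∫ x, f x ∂μ

/-- The functional `τ_μ : a ↦ ∫ E(q_N(a)) dμ` on `C*_N(G)`. -/
noncomputable def canonicalTrace {N : CStarNorm G} (hN : N.DominatesReduced)
    (μ : Measure (UnitSpace G)) (a : GroupoidCStar N) : ℂ :=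
  ∫ u, condExpUnits (quotientMap hN a) u ∂μ

/-- The tracial state `τ` on `C*_N(G)` is canonical: `τ = τ_μ` where `μ` is the probability Radon
measure associated to `τ`. -/
def IsCanonical {N : CStarNorm G} (hN : N.DominatesReduced) (τ : GroupoidCStar N →L[ℂ] ℂ) :
    Prop :=
  ∃ μ : Measure (UnitSpace G), IsProbabilityMeasure μ ∧ μ.Regular ∧ IsAssociatedMeasure τ μ ∧
    ∀ a, τ a = canonicalTrace hN μ a

end Trace

end EtaleGroupoid

/-!
The equivalence comes from comparing two functionals on `C_c(G)`: the canonical one,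
`g ↦ ∫ g(x) dμ(x)`, and the fixed point trace, `g ↦ ∫ ∑_{γ ∈ G_x^x} g(γ) dμ(x)`. Both restrict to
`μ` on the unit space.

*Essential freeness forces every tracial state to be canonical.* As the unit space is clopen, it
suffices that a tracial state `τ` with measure `μ` kills every `g` supported in an open bisection
`B` off the unit space. Away from `Fix(α_B)` the source of the support is covered by open sets `U`
with `α_B(U) ∩ U = ∅`, and `τ(g h) = τ(√h g √h) = 0` for `h ≥ 0` supported in `U`
(`IsTracialState.map_mul_extendZero_eq_zero`). What remains is `g h` with `0 ≤ h ≤ 1` supported in a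
neighbourhood of `Fix(α_B)` of small measure, and Cauchy–Schwarz bounds it by `∫ h² dμ`
(`IsTracialState.eq_zero_of_isEssentiallyFree`). Density of `C_c(G)` gives the formula on the
completion (`eq_canonicalTrace`).

*The fixed point trace is a tracial state on the maximal C*-algebra.* The groupoid acts on its unit
space, so `C_c(G)` acts on `ℓ²(G⁰)`, the unit space taken as a discrete set, by an `I`-norm
contractive `*`-representation (`orbitHom`), and the sum of `g` over the isotropy group at `x` is
its vector functional at `δ_x` (`isotropySum_eq_inner`). Hence the fixed point trace is positive and
bounded by the maximal norm; invariance of `μ` makes it tracial (`fixedPointTrace_mul_comm`), and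
regularity of `μ` makes its norm one (`exists_tracialState_extension`). In the essentially free case
it agrees with the canonical functional and is therefore bounded by every norm dominating the
reduced one.

*A canonical fixed point trace forces essential freeness.* A canonical trace vanishes on functions
supported off the unit space, whereas the fixed point trace of a bump function on `B` detects the
measure of compact subsets of `Fix(α_B)` (`isEssentiallyFree_of_fixedPointTrace`).
-/

namespace EtaleGroupoid

open Gpd

/-! ### The representation on square-summable functions on the unit space -/

section OrbitRep

open Set Topology

variable {G : Type u} [TopologicalSpace G] [TopGpd G]

/-- The action of `f` on functions on the unit space, `(f · ξ)(y) = ∑_{r(γ) = y} f(γ) ξ(s(γ))`.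
It is encoded by letting `f` act on the right-invariant function `ξ ∘ r` on the fibre `G_y` and
evaluating at the unit. -/
noncomputable def orbitConv (f : G → ℂ) (ξ : UnitSpace G → ℂ) (y : UnitSpace G) : ℂ :=
  fiberConv f (fun α : Fiber y => ξ (rng α.1)) (unitFiber y)

theorem div_unitFiber_left {G : Type u} [Gpd G] {x : UnitSpace G} (α : Fiber x) :
    div (unitFiber x) α = inv α.1 := by
  rw [← inv_div, div_unit]

theorem orbitConv_eq_finsum (f : G → ℂ) (ξ : UnitSpace G → ℂ) (y : UnitSpace G) :
    orbitConv f ξ y = ∑ᶠ α : Fiber y, f (inv α.1) * ξ (rng α.1) :=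
  finsum_congr fun α => by rw [div_unitFiber_left]

theorem fiberConv_comp_rng (f : G → ℂ) (ξ : UnitSpace G → ℂ) {x : UnitSpace G} (γ : Fiber x) :
    fiberConv f (fun α : Fiber x => ξ (rng α.1)) γ = orbitConv f ξ (rng γ.1) := by
  rw [orbitConv_eq_finsum, ← finsum_comp_equiv (divEquiv γ)]
  refine finsum_congr fun α => ?_
  have h1 : ((divEquiv γ) α).1 = div α γ := rfl
  rw [h1, inv_div, rng_div]

/-- Sums over the arrows from `x` to `y`, enumerated in `G_y` through their inverses or in `G_x`. -/
theorem finsum_fiber_inv (F : G → ℂ) (x y : UnitSpace G) [DecidableEq (UnitSpace G)] :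
    (∑ᶠ α : Fiber y, if rng α.1 = x then F (inv α.1) else 0) =
      ∑ᶠ β : Fiber x, if rng β.1 = y then F β.1 else 0 := by
  let e : {α : Fiber y // rng α.1 = x} ≃ {β : Fiber x // rng β.1 = y} :=
    { toFun := fun α => ⟨⟨inv α.1.1, by rw [src_inv, α.2]⟩, by rw [rng_inv, α.1.2]⟩
      invFun := fun β => ⟨⟨inv β.1.1, by rw [src_inv, β.2]⟩, by rw [rng_inv, β.1.2]⟩
      left_inv := fun α => Subtype.ext (Subtype.ext (inv_inv' _))
      right_inv := fun α => Subtype.ext (Subtype.ext (inv_inv' _)) }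
  have h1 : ∀ (z w : UnitSpace G) (H : G → ℂ),
      (∑ᶠ α : Fiber z, if rng α.1 = w then H α.1 else 0) =
        ∑ᶠ α : {α : Fiber z // rng α.1 = w}, H α.1.1 := fun z w H => by
    rw [finsum_subtype_eq_finsum_cond (f := fun α : Fiber z => H α.1) (fun α => rng α.1 = w)]
    refine finsum_congr fun α => ?_
    rw [finsum_eq_if]
  rw [h1 y x (fun γ => F (inv γ)), h1 x y F, ← finsum_comp_equiv e]
  rfl

theorem orbitConv_single [DecidableEq (UnitSpace G)] (f : G → ℂ) (x y : UnitSpace G) :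
    orbitConv f (Pi.single x 1) y = ∑ᶠ β : Fiber x, if rng β.1 = y then f β.1 else 0 := by
  rw [orbitConv_eq_finsum, ← finsum_fiber_inv]
  refine finsum_congr fun α => ?_
  by_cases h : rng α.1 = x
  · simp [h]
  · simp [h]

variable [IsEtale G] [LocallyCompactSpace G] [T2Space G]

theorem orbitConv_conv (f g : Cc G) (ξ : UnitSpace G → ℂ) (y : UnitSpace G) :
    orbitConv (conv f g) ξ y = orbitConv f (orbitConv g ξ) y := by
  rw [orbitConv, fiberConv_conv, orbitConv]
  congr 1
  funext α
  exact fiberConv_comp_rng g ξ α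

theorem Cc.finite_inv (f : Cc G) (y : UnitSpace G) : {α : Fiber y | f (inv α.1) ≠ 0}.Finite := by
  simpa only [div_unitFiber_left] using f.finite_left (unitFiber y)

/-- The finite set of `α ∈ G_y` whose inverses carry `f`. -/
noncomputable def Cc.invSupp (f : Cc G) (y : UnitSpace G) : Finset (Fiber y) :=
  (f.finite_inv y).toFinset

theorem Cc.eq_zero_of_notMem_invSupp (f : Cc G) {y : UnitSpace G} {α : Fiber y}
    (h : α ∉ f.invSupp y) : f (inv α.1) = 0 := by
  simpa [Cc.invSupp] using h

theorem orbitConv_eq_sum (f : Cc G) (ξ : UnitSpace G → ℂ) (y : UnitSpace G) :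
    orbitConv f ξ y = ∑ α ∈ f.invSupp y, f (inv α.1) * ξ (rng α.1) := by
  rw [orbitConv_eq_finsum]
  refine finsum_eq_sum_of_support_subset _ fun α hα => ?_
  by_contra h
  exact hα (by simp [f.eq_zero_of_notMem_invSupp h])

theorem sum_inv_le_iNorm (f : Cc G) (y : UnitSpace G) (s : Finset (Fiber y)) :
    ∑ α ∈ s, ‖f (inv α.1)‖ ≤ iNorm f := by
  simpa only [div_unitFiber_left] using sum_div_le_iNorm' f (unitFiber y) s

theorem sum_le_iNorm (f : Cc G) (x : UnitSpace G) (s : Finset (Fiber x)) :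
    ∑ γ ∈ s, ‖f γ.1‖ ≤ iNorm f :=
  ((f.summable_fiber x).sum_le_tsum s fun _ _ => norm_nonneg _).trans (tsum_fiber_le_iNorm f x)

/-- Schur test for the action on functions on the unit space. -/
theorem sum_orbitConv_le (f : Cc G) (ξ : lp (fun _ : UnitSpace G => ℂ) 2)
    (s : Finset (UnitSpace G)) :
    ∑ y ∈ s, ‖orbitConv f ξ y‖ ^ 2 ≤ (iNorm f * ‖ξ‖) ^ 2 := by
  classical
  have h1 : ∀ y ∈ s, ‖orbitConv f ξ y‖ ^ 2 ≤
      iNorm f * ∑ α ∈ f.invSupp y, ‖f (inv α.1)‖ * ‖ξ (rng α.1)‖ ^ 2 := fun y _ => by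
    have h2 : ‖orbitConv f ξ y‖ ≤ ∑ α ∈ f.invSupp y, ‖f (inv α.1)‖ * ‖ξ (rng α.1)‖ := by
      rw [orbitConv_eq_sum]
      exact (norm_sum_le _ _).trans (le_of_eq (Finset.sum_congr rfl fun _ _ => norm_mul _ _))
    refine (pow_le_pow_left₀ (norm_nonneg _) h2 2).trans ?_
    refine (Finset.sum_sq_le_sum_mul_sum_of_sq_le_mul (f.invSupp y)
      (f := fun α => ‖f (inv α.1)‖) (g := fun α => ‖f (inv α.1)‖ * ‖ξ (rng α.1)‖ ^ 2)
      (fun _ _ => norm_nonneg _) (fun _ _ => by positivity) fun _ _ => le_of_eq (by ring)).trans ?_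
    exact mul_le_mul_of_nonneg_right (sum_inv_le_iNorm f y _)
      (Finset.sum_nonneg fun _ _ => by positivity)
  -- the arrows `γ` with `r(γ) ∈ s` that carry `f`, and the set of their sources
  set R : Finset G := s.biUnion fun y => (f.invSupp y).image fun α => inv α.1 with hR
  set S : Finset (UnitSpace G) := R.image src with hS
  have h3 : ∑ y ∈ s, ∑ α ∈ f.invSupp y, ‖f (inv α.1)‖ * ‖ξ (rng α.1)‖ ^ 2 =
      ∑ γ ∈ R, ‖f γ‖ * ‖ξ (src γ)‖ ^ 2 := by
    rw [hR, Finset.sum_biUnion]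
    · refine Finset.sum_congr rfl fun y _ => ?_
      rw [Finset.sum_image]
      · exact Finset.sum_congr rfl fun α _ => by rw [src_inv]
      · intro α _ β _ h
        refine Subtype.ext ?_
        rw [← inv_inv' α.1, ← inv_inv' β.1]
        exact congrArg inv h
    · intro y _ z _ hyz
      refine Finset.disjoint_left.2 fun γ h h' => hyz ?_
      obtain ⟨α, -, rfl⟩ := Finset.mem_image.1 h
      obtain ⟨β, -, e⟩ := Finset.mem_image.1 h'
      have := congrArg rng e
      rw [rng_inv, rng_inv, α.2, β.2] at this
      exact this.symm
  have h4 : ∀ x ∈ S, ∑ γ ∈ R with src γ = x, ‖f γ‖ ≤ iNorm f := fun x _ => by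
    refine le_trans (le_of_eq ?_) (sum_le_iNorm f x (R.subtype fun γ => src γ = x))
    rw [Finset.sum_subtype_eq_sum_filter (fun γ => ‖f γ‖)]
  calc ∑ y ∈ s, ‖orbitConv f ξ y‖ ^ 2
      ≤ iNorm f * ∑ y ∈ s, ∑ α ∈ f.invSupp y, ‖f (inv α.1)‖ * ‖ξ (rng α.1)‖ ^ 2 := by
        rw [Finset.mul_sum]; exact Finset.sum_le_sum h1
    _ = iNorm f * ∑ x ∈ S, (∑ γ ∈ R with src γ = x, ‖f γ‖) * ‖ξ x‖ ^ 2 := by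
        rw [h3, ← Finset.sum_fiberwise_of_maps_to (t := S)
          (fun γ hγ => Finset.mem_image_of_mem src hγ)]
        congr 1
        refine Finset.sum_congr rfl fun x _ => ?_
        rw [Finset.sum_mul]
        exact Finset.sum_congr rfl fun γ hγ => by rw [(Finset.mem_filter.1 hγ).2]
    _ ≤ iNorm f * ∑ x ∈ S, iNorm f * ‖ξ x‖ ^ 2 :=
        mul_le_mul_of_nonneg_left (Finset.sum_le_sum fun x hx =>
          mul_le_mul_of_nonneg_right (h4 x hx) (by positivity)) (iNorm_nonneg f)
    _ = iNorm f ^ 2 * ∑ x ∈ S, ‖ξ x‖ ^ 2 := by rw [← Finset.mul_sum]; ring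
    _ ≤ iNorm f ^ 2 * ‖ξ‖ ^ 2 := by
        refine mul_le_mul_of_nonneg_left ?_ (by positivity)
        have := lp.sum_rpow_le_norm_rpow (p := 2) (by norm_num) ξ S
        simpa using this
    _ = (iNorm f * ‖ξ‖) ^ 2 := by ring

variable (G) in
/-- The Hilbert space `ℓ²(G⁰)` of the unit space as a discrete set. -/
abbrev UnitL2 : Type u := lp (fun _ : UnitSpace G => ℂ) 2

/-- The operator `ξ ↦ f · ξ` on `ℓ²(G⁰)`. -/
noncomputable def orbitOp (f : Cc G) : UnitL2 G →L[ℂ] UnitL2 G :=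
  LinearMap.mkContinuous
    { toFun := fun ξ => ⟨orbitConv f ξ, memℓp_gen' (C := (iNorm f * ‖ξ‖) ^ 2) fun s => by
        simpa using sum_orbitConv_le f ξ s⟩
      map_add' := fun ξ η => by
        apply Subtype.ext; funext y
        exact fiberConv_add_right f (fun α : Fiber y => ξ (rng α.1)) (fun α => η (rng α.1)) _
      map_smul' := fun c ξ => by
        apply Subtype.ext; funext y
        exact fiberConv_smul_right c f (fun α : Fiber y => ξ (rng α.1)) _ }
    (iNorm f) fun ξ => by
      refine lp.norm_le_of_forall_sum_le (by norm_num)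
        (mul_nonneg (iNorm_nonneg f) (norm_nonneg _)) fun s => ?_
      simpa using sum_orbitConv_le f ξ s

theorem orbitOp_apply (f : Cc G) (ξ : UnitL2 G) (y : UnitSpace G) :
    orbitOp f ξ y = orbitConv f ξ y := rfl

theorem norm_orbitOp_le (f : Cc G) : ‖orbitOp f‖ ≤ iNorm f :=
  LinearMap.mkContinuous_norm_le _ (iNorm_nonneg f) _

theorem orbitOp_single [DecidableEq (UnitSpace G)] (f : Cc G) (x y : UnitSpace G) :
    orbitOp f (lp.single 2 x 1) y = ∑ᶠ β : Fiber x, if rng β.1 = y then f β.1 else 0 := by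
  rw [orbitOp_apply, lp.coeFn_single, orbitConv_single]

/-- The representation of `C_c(G)` on `ℓ²(G⁰)`: the direct sum over the orbits of the
quasi-regular representations, in which `f` sends `δ_x` to `∑_{s(γ) = x} f(γ) δ_{r(γ)}`. -/
noncomputable def orbitHom : Cc G →⋆ₙₐ[ℂ] (UnitL2 G →L[ℂ] UnitL2 G) where
  toFun := orbitOp
  map_smul' c f := by
    ext ξ y; exact fiberConv_smul_left c f (fun α : Fiber y => ξ (rng α.1)) _
  map_zero' := by
    ext ξ y
    rw [orbitOp_apply, orbitConv_eq_finsum]; simp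
  map_add' f g := by
    ext ξ y; exact fiberConv_add_left f g (fun α : Fiber y => ξ (rng α.1)) _
  map_mul' f g := by
    ext ξ y; exact orbitConv_conv f g ξ y
  map_star' f := by
    classical
    ext ξ y
    have h1 : (star (orbitOp f) ξ : UnitL2 G) y =
        inner ℂ (lp.single 2 y 1 : UnitL2 G) (star (orbitOp f) ξ) := by
      rw [lp.inner_single_left]; simp
    have h2 : inner ℂ (lp.single 2 y 1 : UnitL2 G) (star (orbitOp f) ξ) =
        inner ℂ (orbitOp f (lp.single 2 y 1)) ξ :=
      ContinuousLinearMap.adjoint_inner_right _ _ _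
    set T : Finset (Fiber y) := (star f).invSupp y with hT
    have hTz : ∀ α : Fiber y, α ∉ T → f α.1 = 0 := fun α hα => by
      have := (star f).eq_zero_of_notMem_invSupp hα
      simpa [Cc.star_apply, inv_inv'] using this
    have h3 : ∀ x, orbitOp f (lp.single 2 y 1) x =
        ∑ β ∈ T, if rng β.1 = x then f β.1 else 0 := fun x => by
      rw [orbitOp_single]
      refine finsum_eq_sum_of_support_subset _ fun α hα => ?_
      by_contra h
      exact hα (by simp [hTz α h])
    rw [h1, h2, lp.inner_eq_tsum, orbitOp_apply, orbitConv_eq_sum,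
      tsum_eq_sum (s := T.image fun α => rng α.1)]
    · simp only [h3, RCLike.inner_apply, map_sum, Finset.mul_sum]
      rw [Finset.sum_comm]
      refine Finset.sum_congr rfl fun α hα => ?_
      rw [Finset.sum_eq_single (rng α.1)]
      · simp [Cc.star_apply, inv_inv', mul_comm]
      · intro x _ hx
        simp [hx.symm]
      · intro h
        exact absurd (Finset.mem_image_of_mem _ hα) h
    · intro x hx
      rw [h3, Finset.sum_eq_zero]
      · simp
      · intro β hβ
        rw [if_neg]
        rintro rfl
        exact hx (Finset.mem_image_of_mem _ hβ)

theorem orbitHom_apply (f : Cc G) : orbitHom f = orbitOp f := rfl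

variable (G) in
/-- The representation on `ℓ²(G⁰)` takes part in the supremum defining the maximal norm. -/
noncomputable def orbitRep : ContractiveRep G where
  H := UnitL2 G
  π := orbitHom
  contractive := norm_orbitOp_le

theorem ContractiveRep.norm_le_maxNorm (ρ : ContractiveRep G) (f : Cc G) :
    ‖ρ.π f‖ ≤ (maxNorm G).toSeminorm f :=
  le_ciSup (f := fun ρ : ContractiveRep G => ‖ρ.π f‖)
    ⟨iNorm f, by rintro _ ⟨ρ, rfl⟩; exact ρ.contractive f⟩ ρ

/-- The isotropy sum at `x` is the vector functional of `δ_x` in the representation on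
`ℓ²(G⁰)`. -/
theorem isotropySum_eq_inner [DecidableEq (UnitSpace G)] (f : Cc G) (x : UnitSpace G) :
    isotropySum f x =
      inner ℂ (lp.single 2 x 1 : UnitL2 G) (orbitHom f (lp.single 2 x 1)) := by
  rw [lp.inner_single_left, orbitHom_apply, orbitOp_single]
  simp only [RCLike.inner_apply, map_one, mul_one]
  unfold isotropySum
  exact finsum_congr fun γ => by congr

theorem norm_isotropySum_le (f : Cc G) (x : UnitSpace G) :
    ‖isotropySum f x‖ ≤ (maxNorm G).toSeminorm f := by
  classical
  rw [isotropySum_eq_inner]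
  refine (norm_inner_le_norm _ _).trans ?_
  have h : ‖(lp.single 2 x 1 : UnitL2 G)‖ = 1 := by
    rw [lp.norm_single (by norm_num)]; simp
  rw [h, one_mul]
  refine ((orbitHom f).le_opNorm _).trans ?_
  rw [h, mul_one]
  exact (orbitRep G).norm_le_maxNorm f

open scoped ComplexOrder in
theorem isotropySum_star_mul_self_nonneg (f : Cc G) (x : UnitSpace G) :
    0 ≤ isotropySum (star f * f) x := by
  classical
  rw [isotropySum_eq_inner, map_mul, map_star, mul_apply_eq_comp,
    ContinuousLinearMap.star_eq_adjoint, ContinuousLinearMap.adjoint_inner_right,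
    inner_self_eq_norm_sq_to_K, ← RCLike.ofReal_pow]
  exact RCLike.ofReal_nonneg.2 (sq_nonneg _)

end OrbitRep

/-! ### Functions on the unit space inside the convolution algebra -/

section Diagonal

open Set Topology

/-- A compactly supported continuous real function as an element of `C_c(X)`. -/
noncomputable def Cc.ofReal {X : Type u} [TopologicalSpace X] (φ : C(X, ℝ))
    (hφ : HasCompactSupport φ) : Cc X :=
  Cc.mk (fun x => (φ x : ℂ)) (Complex.continuous_ofReal.comp φ.continuous)
    (hφ.comp_left Complex.ofReal_zero)

@[simp] theorem Cc.ofReal_apply {X : Type u} [TopologicalSpace X] (φ : C(X, ℝ))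
    (hφ : HasCompactSupport φ) (x : X) : Cc.ofReal φ hφ x = (φ x : ℂ) := rfl

theorem src_eq_of_mem_units {G : Type u} [Gpd G] {γ : G} (h : γ ∈ (units : Set G)) :
    ((src γ : UnitSpace G) : G) = γ :=
  congrArg Subtype.val (src_unit ⟨γ, h⟩)

theorem rng_eq_of_mem_units {G : Type u} [Gpd G] {γ : G} (h : γ ∈ (units : Set G)) :
    ((rng γ : UnitSpace G) : G) = γ :=
  congrArg Subtype.val (rng_unit ⟨γ, h⟩)

theorem inv_unit {G : Type u} [Gpd G] (x : UnitSpace G) : inv (x : G) = x := by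
  have h := (div_unitFiber_left (unitFiber x)).symm.trans (div_unit (unitFiber x))
  exact h

theorem isClosed_units {G : Type u} [TopologicalSpace G] [TopGpd G] [T2Space G] :
    IsClosed (units : Set G) := by
  have : (units : Set G) = {γ | ((src γ : UnitSpace G) : G) = γ} := by
    ext γ
    exact ⟨src_eq_of_mem_units, fun h => h ▸ (src γ).2⟩
  rw [this]
  exact isClosed_eq (continuous_subtype_val.comp TopGpd.continuous_src) continuous_id

variable {G : Type u} [TopologicalSpace G] [TopGpd G] [IsEtale G] [LocallyCompactSpace G]
  [T2Space G]

theorem mul_extendZero (f : Cc G) (h : Cc (UnitSpace G)) (γ : G) :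
    (f * extendZero h) γ = f γ * h (src γ) := by
  refine (finsum_eq_single _ (unitFiber (src γ)) fun α hα => ?_).trans ?_
  · rw [extendZero_of_notMem, mul_zero]
    intro hu
    refine hα (Subtype.ext ?_)
    rw [← src_eq_of_mem_units hu, α.2]; rfl
  · rw [div_unit]
    exact congrArg _ (extendZero_unit h (src γ))

theorem extendZero_mul (h : Cc (UnitSpace G)) (f : Cc G) (γ : G) :
    (extendZero h * f) γ = h (rng γ) * f γ := by
  refine (finsum_eq_single _ (⟨γ, rfl⟩ : Fiber (src γ)) fun α hα => ?_).trans ?_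
  · rw [extendZero_of_notMem, zero_mul]
    intro hu
    refine hα (div_left_injective ⟨γ, rfl⟩ ?_)
    rw [← rng_eq_of_mem_units hu, rng_div, div_self]
  · rw [div_self, extendZero_unit]

theorem extendZero_ext {f : Cc G} {h : Cc (UnitSpace G)} (h0 : ∀ γ ∉ (units : Set G), f γ = 0)
    (h1 : ∀ x : UnitSpace G, f x = h x) : f = extendZero h := by
  ext γ
  by_cases hγ : γ ∈ (units : Set G)
  · exact (h1 ⟨γ, hγ⟩).trans (extendZero_unit h ⟨γ, hγ⟩).symm
  · rw [h0 γ hγ, extendZero_of_notMem h hγ]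

theorem extendZero_mul_extendZero {f g h : Cc (UnitSpace G)} (e : ∀ x, f x * g x = h x) :
    (extendZero f * extendZero g : Cc G) = extendZero h := by
  refine extendZero_ext (fun γ hγ => ?_) fun x => ?_
  · rw [mul_extendZero, extendZero_of_notMem f hγ, zero_mul]
  · rw [mul_extendZero, extendZero_unit, src_unit, e]

theorem star_extendZero {f g : Cc (UnitSpace G)} (e : ∀ x, (starRingEnd ℂ) (f x) = g x) :
    star (extendZero f : Cc G) = extendZero g := by
  refine extendZero_ext (fun γ hγ => ?_) fun x => ?_
  · rw [Cc.star_apply, extendZero_of_notMem, map_zero]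
    intro h
    refine hγ ?_
    have := inv_unit (⟨inv γ, h⟩ : UnitSpace G)
    rw [inv_inv'] at this
    rw [this]; exact h
  · rw [Cc.star_apply, inv_unit, extendZero_unit, e]

/-- If `|f| ≤ 1 < |c|` then `1 - f/c` is invertible, with inverse `1 + f/(c - f)`; the function
`f/(c - f)` has compact support. -/
theorem isQuasiregular_extendZero (f : Cc (UnitSpace G)) (hf : ∀ x, ‖f x‖ ≤ 1) {c : ℂ}
    (hc : 1 < ‖c‖) : IsQuasiregular (-(c⁻¹ • (extendZero f : Cc G))) := by
  have hc0 : c ≠ 0 := by rintro rfl; simp at hc; linarith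
  have hne : ∀ x, c - f x ≠ 0 := fun x h => by
    rw [sub_eq_zero] at h
    exact absurd (hf x) (by rw [← h]; exact not_le.2 hc)
  let k : Cc (UnitSpace G) := Cc.mk (fun x => f x * (c - f x)⁻¹)
    (f.continuous.mul ((continuous_const.sub f.continuous).inv₀ hne))
    f.hasCompactSupport.mul_right
  have hk : ∀ x, k x = f x * (c - f x)⁻¹ := fun x => rfl
  rw [isQuasiregular_iff]
  refine ⟨extendZero k, ?_, ?_⟩ <;> ext γ <;> by_cases hγ : γ ∈ (units : Set G)
  · lift γ to UnitSpace G using hγ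
    simp only [neg_mul, smul_mul_assoc, Cc.add_apply, Cc.neg_apply, Cc.smul_apply, Cc.zero_apply,
      mul_extendZero, extendZero_unit, src_unit, hk]
    have := hne γ
    field_simp
    ring
  · simp [mul_extendZero, extendZero_of_notMem _ hγ]
  · lift γ to UnitSpace G using hγ
    simp only [mul_neg, mul_smul_comm, Cc.add_apply, Cc.neg_apply, Cc.smul_apply, Cc.zero_apply,
      mul_extendZero, extendZero_unit, src_unit, hk]
    have := hne γ
    field_simp
    ring
  · simp [mul_extendZero, extendZero_of_notMem _ hγ, mul_smul_comm]

/-- Every C*-norm on `C_c(G)` is bounded by the sup norm on real functions on the unit space,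
since it is the spectral radius of self-adjoint elements. -/
theorem CStarNorm.extendZero_le_one (N : CStarNorm G) (f : Cc (UnitSpace G))
    (hf : ∀ x, ‖f x‖ ≤ 1) (hr : ∀ x, (starRingEnd ℂ) (f x) = f x) :
    N.toSeminorm (extendZero f) ≤ 1 := by
  set a := GroupoidCStar.ofCc N (extendZero f) with ha
  have hN : N.toSeminorm (extendZero f) = ‖a‖ :=
    (GroupoidCStar.norm_coeL N (toNormed N (extendZero f))).symm
  have hsa : IsSelfAdjoint a := by
    rw [isSelfAdjoint_iff, ha, ← map_star, star_extendZero hr]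
  have h1 : spectralRadius ℂ (a : Unitization ℂ (GroupoidCStar N)) ≤ 1 := by
    refine iSup₂_le fun k hk => ?_
    rw [← Unitization.quasispectrum_eq_spectrum_inr'] at hk
    by_contra hlt
    have hk1 : 1 < ‖k‖ := by
      rw [not_le] at hlt
      exact_mod_cast hlt
    have hk0 : IsUnit k := by
      rw [isUnit_iff_ne_zero]; rintro rfl; simp at hk1; linarith
    refine hk hk0 ?_
    have := (isQuasiregular_extendZero f hf hk1).map (GroupoidCStar.ofCc N)
    rw [map_neg, map_smul] at this
    have e : (hk0.unit⁻¹ • a : GroupoidCStar N) = k⁻¹ • a := by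
      rw [Units.smul_def]; simp
    rw [e]; exact this
  rw [(hsa.inr ℂ).spectralRadius_eq_nnnorm] at h1
  have h2 : ‖(a : Unitization ℂ (GroupoidCStar N))‖ ≤ 1 := by exact_mod_cast h1
  rw [Unitization.norm_inr] at h2
  rwa [hN]

theorem isotropySum_extendZero (f : Cc (UnitSpace G)) (x : UnitSpace G) :
    isotropySum (extendZero f) x = f x := by
  unfold isotropySum
  rw [finsum_eq_single _ (unitFiber x)]
  · rw [if_pos (show rng (unitFiber x).1 = x from rng_unit x)]
    exact extendZero_unit f x
  · intro α hα
    rw [extendZero_of_notMem, ite_self]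
    intro hu
    refine hα (Subtype.ext ?_)
    rw [← src_eq_of_mem_units hu, α.2]; rfl

end Diagonal

/-! ### The fixed point trace of an invariant measure -/

section TraceProperty

open Set Topology MeasureTheory

variable {G : Type u} [TopologicalSpace G] [TopGpd G]

theorem isotropySum_eq_orbitConv [DecidableEq (UnitSpace G)] (f : Cc G) (x : UnitSpace G) :
    isotropySum f x = orbitConv f (Pi.single x 1) x := by
  rw [orbitConv_single]
  exact finsum_congr fun γ => by congr

theorem orbitConv_of_mem {B : Set G} (hB : IsBisection B) {g : Cc G} (hg : tsupport g ⊆ B) {β : G}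
    (hβ : β ∈ B) (ξ : UnitSpace G → ℂ) : orbitConv g ξ (rng β) = g β * ξ (src β) := by
  rw [orbitConv_eq_finsum, finsum_eq_single _ (⟨inv β, src_inv β⟩ : Fiber (rng β))]
  · rw [inv_inv', rng_inv]
  · intro α hα
    by_contra h
    refine hα (Subtype.ext ?_)
    have h1 : inv α.1 = β := hB.rng_injOn (hg (subset_tsupport _ (left_ne_zero_of_mul h))) hβ
      (by rw [rng_inv, α.2])
    exact (inv_inv' α.1).symm.trans (congrArg inv h1)

theorem orbitConv_of_notMem {B : Set G} {g : Cc G} (hg : tsupport g ⊆ B) {y : UnitSpace G}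
    (hy : y ∉ (rng '' B : Set (UnitSpace G))) (ξ : UnitSpace G → ℂ) : orbitConv g ξ y = 0 := by
  rw [orbitConv_eq_finsum]
  refine finsum_eq_zero_of_forall_eq_zero fun α => ?_
  by_contra h
  exact hy ⟨inv α.1, hg (subset_tsupport _ (left_ne_zero_of_mul h)), by rw [rng_inv, α.2]⟩

theorem orbitConv_single_of_mem [DecidableEq (UnitSpace G)] {B : Set G} (hB : IsBisection B)
    {g : Cc G} (hg : tsupport g ⊆ B) {β : G} (hβ : β ∈ B) :
    orbitConv g (Pi.single (src β) 1) = g β • Pi.single (rng β) (1 : ℂ) := by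
  funext y
  by_cases hy : y ∈ (rng '' B : Set (UnitSpace G))
  · obtain ⟨γ, hγ, rfl⟩ := hy
    rw [orbitConv_of_mem hB hg hγ]
    by_cases h : γ = β
    · subst h; simp
    · have h1 : src γ ≠ src β := fun e => h (hB.src_injOn hγ hβ e)
      have h2 : rng γ ≠ rng β := fun e => h (hB.rng_injOn hγ hβ e)
      simp [h1, h2]
  · rw [orbitConv_of_notMem hg hy]
    have h2 : y ≠ rng β := fun e => hy ⟨β, hβ, e.symm⟩
    simp [h2]

theorem orbitConv_single_of_notMem [DecidableEq (UnitSpace G)] {B : Set G}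
    {g : Cc G} (hg : tsupport g ⊆ B) {x : UnitSpace G}
    (hx : x ∉ (src '' B : Set (UnitSpace G))) : orbitConv g (Pi.single x 1) = 0 := by
  funext y
  rw [orbitConv_single]
  refine finsum_eq_zero_of_forall_eq_zero fun β => ?_
  have : g β.1 = 0 := by
    by_contra h
    exact hx ⟨β.1, hg (subset_tsupport _ h), β.2⟩
  simp [this]

/-- The map `α_B` of a bisection is a homeomorphism from `s(B)` onto `r(B)`. -/
theorem IsBisection.exists_homeomorph {B : Set G} (hB : IsBisection B) :
    ∃ e : ↥(src '' B : Set (UnitSpace G)) ≃ₜ ↥(rng '' B : Set (UnitSpace G)),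
      ⇑e = bisectionMap B := by
  have hs : range (B.domRestrict (src : G → UnitSpace G)) = src '' B := by simp
  have hr : range (B.domRestrict (rng : G → UnitSpace G)) = rng '' B := by simp
  let e1 := hB.1.toHomeomorph
  let e2 := hB.2.toHomeomorph
  refine ⟨((Homeomorph.setCongr hs.symm).trans e1.symm).trans (e2.trans (Homeomorph.setCongr hr)),
    funext fun x => Subtype.ext ?_⟩
  have h1 : (e1.symm (Homeomorph.setCongr hs.symm x)).1 = bisectionSection B x := by
    refine hB.src_injOn (Subtype.coe_prop _) (bisectionSection_mem B x) ?_
    rw [src_bisectionSection]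
    exact congrArg Subtype.val (e1.apply_symm_apply (Homeomorph.setCongr hs.symm x))
  exact congrArg rng h1

variable [IsEtale G] [LocallyCompactSpace G] [T2Space G]
  [MeasurableSpace (UnitSpace G)] [BorelSpace (UnitSpace G)]

/-- Change of variables along an open bisection for an invariant measure; no measurability of the
integrands is needed because `α_B` is a homeomorphism. -/
theorem IsInvariant.integral_eq {μ : Measure (UnitSpace G)} (hμ : IsInvariant μ) {B : Set G}
    (hO : IsOpen B) (hB : IsBisection B) {u v : UnitSpace G → ℂ}
    (hu : ∀ x ∉ (src '' B : Set (UnitSpace G)), u x = 0)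
    (hv : ∀ y ∉ (rng '' B : Set (UnitSpace G)), v y = 0)
    (huv : ∀ β ∈ B, u (src β) = v (rng β)) : ∫ x, u x ∂μ = ∫ x, v x ∂μ := by
  have hms : MeasurableSet (src '' B : Set (UnitSpace G)) := (isOpen_src_image hO).measurableSet
  have hmr : MeasurableSet (rng '' B : Set (UnitSpace G)) :=
    (IsEtale.isLocalHomeomorph_rng.isOpenMap B hO).measurableSet
  obtain ⟨e, he⟩ := hB.exists_homeomorph
  rw [← setIntegral_eq_integral_of_forall_compl_eq_zero hu,
    ← setIntegral_eq_integral_of_forall_compl_eq_zero hv, ← integral_subtype_comap hms,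
    ← integral_subtype_comap hmr, hμ B hO hB, ← he, e.measurableEmbedding.integral_map, he]
  congr 1
  funext x
  have := huv _ (bisectionSection_mem B x)
  rw [src_bisectionSection] at this
  exact this

theorem fixedPointTrace_eq_integral (μ : Measure (UnitSpace G)) [IsFiniteMeasure μ] (f : Cc G) :
    fixedPointTrace μ f = ∫ x, isotropySum f x ∂μ := by
  induction f using Cc.induction with
  | h0 =>
    rw [map_zero]
    simp [isotropySum]
  | hadd f g hf hg =>
    rw [map_add, hf, hg, ← integral_add (integrable_isotropySum μ f) (integrable_isotropySum μ g)]
    simp only [isotropySum_add]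
  | hB B g hB hg =>
    rw [fixedPointTrace_apply μ hB hg, hB.isotropySum_eq hg,
      integral_indicator hB.measurableSet_fixSet]

theorem fixedPointTrace_mul_comm {μ : Measure (UnitSpace G)} [IsFiniteMeasure μ]
    (hμ : IsInvariant μ) (f g : Cc G) : fixedPointTrace μ (f * g) = fixedPointTrace μ (g * f) := by
  classical
  induction g using Cc.induction with
  | h0 => simp
  | hadd g h hg hh => rw [mul_add, add_mul, map_add, map_add, hg, hh]
  | hB B g hB hg =>
    have h1 : ∀ x, isotropySum (f * g) x = orbitConv f (orbitConv g (Pi.single x 1)) x :=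
      fun x => by rw [isotropySum_eq_orbitConv, Cc.coe_mul, orbitConv_conv]
    have h2 : ∀ x, isotropySum (g * f) x = orbitConv g (orbitConv f (Pi.single x 1)) x :=
      fun x => by rw [isotropySum_eq_orbitConv, Cc.coe_mul, orbitConv_conv]
    rw [fixedPointTrace_eq_integral, fixedPointTrace_eq_integral]
    refine hμ.integral_eq hB.isOpen hB.isBisection (fun x hx => ?_) (fun y hy => ?_) fun β hβ => ?_
    · rw [h1, orbitConv_single_of_notMem hg hx, orbitConv_eq_finsum]
      simp
    · rw [h2, orbitConv_of_notMem hg hy]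
    -- both sides are `g(β) ∑ f(γ)`, summed over the arrows `γ` from `r(β)` to `s(β)`
    · rw [h1, h2, orbitConv_single_of_mem hB.isBisection hg hβ,
        orbitConv_of_mem hB.isBisection hg hβ]
      exact fiberConv_smul_right (g β) f
        (fun α : Fiber (src β) => (Pi.single (rng β) 1 : UnitSpace G → ℂ) (rng α.1)) _

open scoped ComplexOrder in
theorem fixedPointTrace_nonneg (μ : Measure (UnitSpace G)) [IsFiniteMeasure μ] (f : Cc G) :
    0 ≤ fixedPointTrace μ (star f * f) := by
  rw [fixedPointTrace_eq_integral]
  exact integral_nonneg fun x => isotropySum_star_mul_self_nonneg f x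

theorem norm_fixedPointTrace_le (μ : Measure (UnitSpace G)) [IsProbabilityMeasure μ] (f : Cc G) :
    ‖fixedPointTrace μ f‖ ≤ (maxNorm G).toSeminorm f := by
  rw [fixedPointTrace_eq_integral]
  refine (norm_integral_le_of_norm_le_const
    (Filter.Eventually.of_forall fun x => norm_isotropySum_le f x)).trans ?_
  simp

theorem fixedPointTrace_extendZero (μ : Measure (UnitSpace G)) [IsFiniteMeasure μ]
    (f : Cc (UnitSpace G)) : fixedPointTrace μ (extendZero f) = ∫ x, f x ∂μ := by
  rw [fixedPointTrace_eq_integral]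
  simp only [isotropySum_extendZero]

end TraceProperty

/-! ### Extension of functionals to tracial states -/

section Extension

open Set Topology MeasureTheory

variable {G : Type u} [TopologicalSpace G] [TopGpd G] [IsEtale G] [LocallyCompactSpace G]
  [T2Space G]

variable (G) in
theorem locallyCompactSpace_units : LocallyCompactSpace (UnitSpace G) :=
  isOpen_units.locallyCompactSpace

variable [MeasurableSpace (UnitSpace G)] [BorelSpace (UnitSpace G)]

open scoped ComplexOrder in
/-- A positive tracial functional on `C_c(G)` that is bounded by a C*-norm and restricts to a
probability measure on the unit space extends to a tracial state; its norm is one because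
functions `0 ≤ f ≤ 1` on the unit space have norm at most one. -/
theorem exists_tracialState_extension (N : CStarNorm G) (φ : Cc G →ₗ[ℂ] ℂ)
    (hb : ∀ f, ‖φ f‖ ≤ N.toSeminorm f) (hpos : ∀ f, 0 ≤ φ (star f * f))
    (htr : ∀ f g, φ (f * g) = φ (g * f)) (μ : Measure (UnitSpace G)) [IsProbabilityMeasure μ]
    [μ.Regular] (hφ : ∀ f : Cc (UnitSpace G), φ (extendZero f) = ∫ x, f x ∂μ) :
    ∃ τ : GroupoidCStar N →L[ℂ] ℂ, IsTracialState τ ∧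
      ∀ f, τ (GroupoidCStar.ofCc N f) = φ f := by
  let ψ : NormedCc N →L[ℂ] ℂ := LinearMap.mkContinuous
    (φ ∘ₗ ((toNormed N).symm : NormedCc N →ₗ[ℂ] Cc G)) 1
    fun f => by rw [one_mul]; exact hb ((toNormed N).symm f)
  let τ : GroupoidCStar N →L[ℂ] ℂ := ContinuousLinearMap.fromCompletion ψ
  have hτ : ∀ f, τ (GroupoidCStar.ofCc N f) = φ f := fun f =>
    ContinuousLinearMap.fromCompletion_apply_coe _ _
  have hle : ∀ a, ‖τ a‖ ≤ ‖a‖ := fun a => by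
    induction a using GroupoidCStar.ind with
    | hc => exact isClosed_le (by fun_prop) (by fun_prop)
    | h f =>
      rw [GroupoidCStar.norm_coeL]
      have := hb ((toNormed N).symm f)
      rwa [← hτ] at this
  refine ⟨τ, ⟨fun a => ?_, le_antisymm ?_ ?_, fun a b => ?_⟩, hτ⟩
  · induction a using GroupoidCStar.ind with
    | hc => exact isClosed_le continuous_const (by fun_prop)
    | h f =>
      have := hpos ((toNormed N).symm f)
      rw [← hτ, map_mul, map_star] at this
      exact this
  · exact τ.opNorm_le_bound zero_le_one fun a => by rw [one_mul]; exact hle a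
  · refine le_of_forall_pos_le_add fun ε hε => ?_
    have := locallyCompactSpace_units G
    obtain ⟨K, -, hK, hKε⟩ := (MeasurableSet.univ (α := UnitSpace G)).exists_isCompact_lt_add
      (measure_ne_top μ _) (ENNReal.ofReal_pos.2 hε).ne'
    obtain ⟨h, h1, hc', -, h01⟩ :=
      exists_continuousMap_one_of_isCompact_subset_isOpen hK isOpen_univ (subset_univ K)
    have hc : HasCompactSupport h := hc'
    have hi : Integrable h μ := h.continuous.integrable_of_hasCompactSupport hc
    have hKr : 1 ≤ μ.real K + ε := by
      have := ENNReal.toReal_mono (by finiteness) hKε.le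
      rw [measure_univ, ENNReal.toReal_add (measure_ne_top μ K) ENNReal.ofReal_ne_top,
        ENNReal.toReal_ofReal hε.le] at this
      exact this
    have hKh : μ.real K ≤ ∫ x, h x ∂μ := by
      rw [← integral_indicator_one hK.measurableSet]
      refine integral_mono ((integrable_const 1).indicator hK.measurableSet) hi fun x => ?_
      by_cases hx : x ∈ K
      · simp [hx, h1 hx]
      · simpa [hx] using (h01 x).1
    have hτh : τ (GroupoidCStar.ofCc N (extendZero (Cc.ofReal h hc))) =
        ((∫ x, h x ∂μ : ℝ) : ℂ) := by
      rw [hτ, hφ]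
      exact integral_ofReal
    have hn : ‖GroupoidCStar.ofCc N (extendZero (Cc.ofReal h hc))‖ ≤ 1 := by
      refine (GroupoidCStar.norm_coeL N (toNormed N _)).le.trans
        (N.extendZero_le_one _ (fun x => ?_) fun x => Complex.conj_ofReal _)
      rw [Cc.ofReal_apply, Complex.norm_real, Real.norm_of_nonneg (h01 x).1]
      exact (h01 x).2
    have := τ.le_opNorm_of_le hn
    rw [hτh, Complex.norm_real, mul_one] at this
    linarith [le_abs_self (∫ x, h x ∂μ), Real.norm_eq_abs (∫ x, h x ∂μ)]
  · induction a, b using GroupoidCStar.ind₂ with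
    | hc => exact isClosed_eq (by fun_prop) (by fun_prop)
    | h f g =>
      have := htr ((toNormed N).symm f) ((toNormed N).symm g)
      rw [← hτ, ← hτ, map_mul (GroupoidCStar.ofCc N), map_mul (GroupoidCStar.ofCc N)] at this
      exact this

end Extension

/-! ### Cauchy–Schwarz for tracial states -/

section CauchySchwarz

open scoped ComplexOrder

theorem IsTracialState.conj_map_star_mul {A : Type*} [NonUnitalCStarAlgebra A] {τ : A →L[ℂ] ℂ}
    (hτ : IsTracialState τ) (a b : A) : (starRingEnd ℂ) (τ (star a * b)) = τ (star b * a) := by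
  have him : ∀ c, (τ (star c * c)).im = 0 := fun c => (Complex.nonneg_iff.1 (hτ.nonneg c)).2.symm
  have h1 := him (a + b)
  have h2 := him (a + Complex.I • b)
  simp only [star_add, star_smul, add_mul, mul_add, smul_mul_assoc, mul_smul_comm, map_add,
    map_smul, smul_eq_mul, Complex.add_im, Complex.mul_im, Complex.mul_re, him, RCLike.star_def,
    Complex.conj_I, Complex.I_re, Complex.I_im, Complex.neg_re, Complex.neg_im] at h1 h2
  apply Complex.ext
  · rw [Complex.conj_re]; linarith
  · rw [Complex.conj_im]; linarith

/-- The Cauchy–Schwarz inequality for the semi-inner product `⟨b, a⟩ = τ(b* a)`. -/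
theorem IsTracialState.norm_sq_le {A : Type*} [NonUnitalCStarAlgebra A] {τ : A →L[ℂ] ℂ}
    (hτ : IsTracialState τ) (a b : A) :
    ‖τ (star b * a)‖ ^ 2 ≤ (τ (star b * b)).re * (τ (star a * a)).re := by
  let core : PreInnerProductSpace.Core ℂ A :=
    { inner := fun b a => τ (star b * a)
      conj_inner_symm := fun x y => hτ.conj_map_star_mul y x
      re_inner_nonneg := fun x => (Complex.nonneg_iff.1 (hτ.nonneg x)).1
      add_left := fun x y z => by rw [star_add, add_mul, map_add]
      smul_left := fun x y r => by rw [star_smul, smul_mul_assoc, map_smul]; rfl }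
  have h := InnerProductSpace.Core.inner_mul_inner_self_le (𝕜 := ℂ) (F := A) (c := core) b a
  have h1 : ‖τ (star b * a)‖ * ‖τ (star a * b)‖ ≤
    (τ (star b * b)).re * (τ (star a * a)).re := h
  rwa [← hτ.conj_map_star_mul b a, RCLike.norm_conj, ← sq] at h1

end CauchySchwarz

/-! ### Canonical traces and restriction to the unit space -/

section Canonical

open Set Topology MeasureTheory

/-- Restriction of functions to the unit space, which is closed. -/
noncomputable def restrictUnits {G : Type u} [TopologicalSpace G] [TopGpd G] [T2Space G]
    (g : Cc G) : Cc (UnitSpace G) :=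
  Cc.mk (fun x => g (x : G)) (g.continuous.comp continuous_subtype_val)
    (g.hasCompactSupport.comp_isClosedEmbedding isClosed_units.isClosedEmbedding_subtypeVal)

theorem IsPrecompactOpenBisection.mono {G : Type u} [TopologicalSpace G] [TopGpd G] [IsEtale G]
    {B C : Set G} (hB : IsPrecompactOpenBisection B)
    (hC : IsOpen C) (h : C ⊆ B) : IsPrecompactOpenBisection C where
  isOpen := hC
  isBisection := isBisection_of_injOn hC (hB.isBisection.src_injOn.mono h)
    (hB.isBisection.rng_injOn.mono h)
  isCompact_closure := hB.isCompact_closure.of_isClosed_subset isClosed_closure (closure_mono h)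

theorem integrable_units {G : Type u} [TopologicalSpace G] [TopGpd G] [T2Space G]
    [MeasurableSpace (UnitSpace G)] [BorelSpace (UnitSpace G)] (μ : Measure (UnitSpace G))
    [IsFiniteMeasure μ] (g : Cc G) :
    Integrable (fun x : UnitSpace G => g x) μ :=
  (restrictUnits g).continuous.integrable_of_hasCompactSupport (restrictUnits g).hasCompactSupport

variable {G : Type u} [TopologicalSpace G] [TopGpd G] [IsEtale G] [LocallyCompactSpace G]
  [T2Space G]

theorem norm_condExpUnits_le (a : GroupoidCStar (reducedNorm G)) (u : UnitSpace G) :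
    ‖condExpUnits a u‖ ≤ ‖a‖ := by
  classical
  have h1 : ‖lamExt u a‖ ≤ ‖a‖ := by
    induction a using GroupoidCStar.ind with
    | hc => exact isClosed_le (by fun_prop) (by fun_prop)
    | h f =>
      have h : lamExt u (GroupoidCStar.coeL (reducedNorm G) f) = lam u f :=
        ContinuousLinearMap.fromCompletion_apply_coe _ _
      rw [h, GroupoidCStar.norm_coeL]
      exact norm_lam_le u _
  have h2 : ∀ ξ : FiberL2 u, ‖ξ‖ = 1 → ‖inner ℂ ξ (lamExt u a ξ)‖ ≤ ‖a‖ := fun ξ hξ => by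
    have h3 := (norm_inner_le_norm (𝕜 := ℂ) ξ (lamExt u a ξ)).trans
      (mul_le_mul_of_nonneg_left ((lamExt u a).le_opNorm ξ) (norm_nonneg ξ))
    rw [hξ, one_mul, mul_one] at h3
    exact h3.trans h1
  refine h2 _ ((lp.norm_single (by norm_num) _ _).trans norm_one)

theorem continuous_condExpUnits (u : UnitSpace G) :
    Continuous fun a : GroupoidCStar (reducedNorm G) => condExpUnits a u := by
  unfold condExpUnits
  fun_prop

/-- If `α_B(U)` is disjoint from `U` and `h ≥ 0` is supported in `U`, then
`τ(g h) = τ(√h g √h) = 0` for `g` supported in `B`. -/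
theorem IsTracialState.map_mul_extendZero_eq_zero {N : CStarNorm G} {τ : GroupoidCStar N →L[ℂ] ℂ}
    (hτ : IsTracialState τ) {B : Set G} {U : Set (UnitSpace G)}
    (hU : ∀ β ∈ B, src β ∈ U → rng β ∉ U) {g : Cc G} (hg : tsupport g ⊆ B)
    (h : C(UnitSpace G, ℝ)) (hc : HasCompactSupport h) (hn : ∀ x, 0 ≤ h x)
    (hs : ∀ x, h x ≠ 0 → x ∈ U) :
    τ (GroupoidCStar.ofCc N (g * extendZero (Cc.ofReal h hc))) = 0 := by
  let k : C(UnitSpace G, ℝ) := ⟨fun x => √(h x), by fun_prop⟩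
  have hkc : HasCompactSupport k := hc.comp_left Real.sqrt_zero
  have h1 : (extendZero (Cc.ofReal k hkc) * extendZero (Cc.ofReal k hkc) : Cc G) =
      extendZero (Cc.ofReal h hc) := by
    refine extendZero_mul_extendZero fun x => ?_
    rw [Cc.ofReal_apply, Cc.ofReal_apply, ← Complex.ofReal_mul]
    exact congrArg _ (Real.mul_self_sqrt (hn x))
  have h2 : (extendZero (Cc.ofReal k hkc) * (g * extendZero (Cc.ofReal k hkc)) : Cc G) = 0 := by
    ext γ
    rw [extendZero_mul, mul_extendZero, Cc.zero_apply]
    by_contra h0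
    have hk : ∀ x, Cc.ofReal k hkc x ≠ 0 → x ∈ U := fun x hx => hs x fun e => hx (by
      rw [Cc.ofReal_apply]
      simp [k, e])
    exact hU γ (hg (subset_tsupport _ (left_ne_zero_of_mul (right_ne_zero_of_mul h0))))
      (hk _ (right_ne_zero_of_mul (right_ne_zero_of_mul h0))) (hk _ (left_ne_zero_of_mul h0))
  rw [← h1, ← mul_assoc, map_mul, hτ.trace, ← map_mul, h2, map_zero, map_zero]

variable [MeasurableSpace (UnitSpace G)] [BorelSpace (UnitSpace G)]

/-- A functional on `C_c(G)` is integration over the unit space as soon as it is so on functions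
supported in the unit space and vanishes on functions supported in a bisection off the unit space,
because the unit space is clopen. -/
theorem eq_integral_units (φ : Cc G →ₗ[ℂ] ℂ) (μ : Measure (UnitSpace G)) [IsFiniteMeasure μ]
    (hφ : ∀ f : Cc (UnitSpace G), φ (extendZero f) = ∫ x, f x ∂μ)
    (h0 : ∀ (B : Set G) (g : Cc G), IsPrecompactOpenBisection B → B ⊆ (units : Set G)ᶜ →
      tsupport g ⊆ B → φ g = 0) (g : Cc G) : φ g = ∫ x : UnitSpace G, g x ∂μ := by
  induction g using Cc.induction with
  | h0 => rw [map_zero]; simp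
  | hadd f g hf hg =>
    rw [map_add, hf, hg, ← integral_add (integrable_units μ f) (integrable_units μ g)]
    rfl
  | hB B g hB hg =>
    set k : Cc G := g - extendZero (restrictUnits g) with hk
    have hk1 : ∀ γ ∈ (units : Set G), k γ = 0 := fun γ hγ => by
      have : extendZero (restrictUnits g) γ = g γ := extendZero_unit (restrictUnits g) ⟨γ, hγ⟩
      rw [hk, sub_eq_add_neg, Cc.add_apply, Cc.neg_apply, this, add_neg_cancel]
    have hk2 : ∀ γ ∉ (units : Set G), k γ = g γ := fun γ hγ => by
      rw [hk, sub_eq_add_neg, Cc.add_apply, Cc.neg_apply, extendZero_of_notMem _ hγ, neg_zero,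
        add_zero]
    have hks : tsupport k ⊆ B ∩ (units : Set G)ᶜ := by
      have h1 : Function.support k ⊆ tsupport g ∩ (units : Set G)ᶜ := fun γ hγ => by
        have hu : γ ∉ (units : Set G) := fun h => hγ (hk1 γ h)
        refine ⟨subset_tsupport _ ?_, hu⟩
        rw [Function.mem_support, ← hk2 γ hu]
        exact hγ
      exact (closure_minimal h1 ((isClosed_tsupport g).inter isOpen_units.isClosed_compl)).trans
        (inter_subset_inter_left _ hg)
    have h1 : φ k = 0 := h0 _ k (hB.mono (hB.isOpen.inter isClosed_units.isOpen_compl)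
      inter_subset_left) inter_subset_right hks
    rw [hk, map_sub, sub_eq_zero] at h1
    rw [h1, hφ]
    rfl

/-- A continuous functional given on `C_c(G)` by integration over the unit space is canonical. -/
theorem eq_canonicalTrace {N : CStarNorm G} (hN : N.DominatesReduced)
    {τ : GroupoidCStar N →L[ℂ] ℂ} {μ : Measure (UnitSpace G)} [IsFiniteMeasure μ]
    (h : ∀ g : Cc G, τ (GroupoidCStar.ofCc N g) = ∫ x : UnitSpace G, g x ∂μ)
    (a : GroupoidCStar N) : τ a = canonicalTrace hN μ a := by
  obtain ⟨b, hb, hba⟩ := mem_closure_iff_seq_limit.1 (GroupoidCStar.denseRange_coeL N a)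
  choose f' hf' using hb
  let f : ℕ → Cc G := fun n => (toNormed N).symm (f' n)
  have hf : ∀ n, GroupoidCStar.ofCc N (f n) = b n := hf'
  have hE : ∀ n u, condExpUnits (quotientMap hN (b n)) u = f n (u : G) := fun n u => by
    rw [← hf n, quotientMap_ofCc, condExpUnits_ofCc]
  have hq : Filter.Tendsto (fun n => quotientMap hN (b n)) Filter.atTop (𝓝 (quotientMap hN a)) :=
    ((quotientMap hN).continuous.tendsto a).comp hba
  obtain ⟨C, hC⟩ := (Metric.isBounded_range_of_tendsto _ hq).exists_norm_le
  have h1 : Filter.Tendsto (fun n => canonicalTrace hN μ (b n)) Filter.atTop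
      (𝓝 (canonicalTrace hN μ a)) := by
    refine tendsto_integral_of_dominated_convergence (fun _ => C) (fun n => ?_)
      (integrable_const C) (fun n => Filter.Eventually.of_forall fun u => ?_)
      (Filter.Eventually.of_forall fun u => ?_)
    · exact (integrable_units μ (f n)).aestronglyMeasurable.congr
        (Filter.Eventually.of_forall fun u => (hE n u).symm)
    · exact (norm_condExpUnits_le _ u).trans (hC _ (mem_range_self n))
    · exact ((continuous_condExpUnits u).tendsto _).comp hq
  have h2 : ∀ n, canonicalTrace hN μ (b n) = τ (b n) := fun n => by
    simp only [canonicalTrace, hE]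
    rw [← hf n]
    exact (h (f n)).symm
  simp only [h2] at h1
  exact tendsto_nhds_unique ((τ.continuous.tendsto a).comp hba) h1

end Canonical

/-! ### Essential freeness and tracial states -/

section EssentiallyFree

open Set Topology MeasureTheory

variable {G : Type u} [TopologicalSpace G] [TopGpd G] [IsEtale G] [LocallyCompactSpace G]
  [T2Space G] [MeasurableSpace (UnitSpace G)] [BorelSpace (UnitSpace G)]

/-- If the fixed point trace sees only the values on the unit space, then testing it against
functions that are `1` on the lift to `B` of a compact subset of `Fix(α_B)` shows that this subset
is null. -/
theorem isEssentiallyFree_of_fixedPointTrace {μ : Measure (UnitSpace G)} [IsFiniteMeasure μ]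
    [μ.Regular] (h : ∀ g : Cc G, (∀ x : UnitSpace G, g x = 0) → fixedPointTrace μ g = 0) :
    IsEssentiallyFree μ := by
  intro B hB hBu
  rw [hB.measurableSet_fixSet.measure_eq_iSup_isCompact_of_ne_top (measure_ne_top μ _)]
  simp only [ENNReal.iSup_eq_zero]
  intro K hKF hK
  let s : Set B := {b | src b.1 ∈ K}
  have hs : IsCompact (Subtype.val '' s : Set G) := by
    refine IsCompact.image ?_ continuous_subtype_val
    rw [hB.isBisection.1.isCompact_iff]
    convert hK
    ext x
    constructor
    · rintro ⟨b, hb, rfl⟩; exact hb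
    · intro hx
      obtain ⟨β, hβ, rfl⟩ := fixSet_subset B (hKF hx)
      exact ⟨⟨β, hβ⟩, hx, rfl⟩
  obtain ⟨φ, hφ1, hc', hφB, hφ01⟩ := exists_continuousMap_one_of_isCompact_subset_isOpen hs
    hB.isOpen (by rintro _ ⟨b, -, rfl⟩; exact b.2)
  have hc : HasCompactSupport φ := hc'
  set g : Cc G := Cc.ofReal φ hc with hg
  have hgB : tsupport g ⊆ B := by
    refine (closure_mono fun γ hγ => ?_).trans hφB
    intro h0
    exact hγ (by rw [hg, Cc.ofReal_apply, h0, Complex.ofReal_zero])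
  have hg0 : ∀ x : UnitSpace G, g x = 0 := fun x => by
    by_contra h0
    exact hBu (hgB (subset_tsupport _ h0)) x.2
  have h1 := h g hg0
  rw [fixedPointTrace_apply μ hB hgB] at h1
  set p : UnitSpace G → ℝ := fun x => (pullSource B g x).re with hp
  have hpg : ∀ x, pullSource B g x = (p x : ℂ) := fun x => by
    simp only [hp, pullSource]
    split_ifs <;> simp [hg]
  have hp01 : ∀ x, 0 ≤ p x ∧ p x ≤ 1 := fun x => by
    simp only [hp, pullSource]
    split_ifs
    · simpa [hg] using hφ01 _
    · simp
  have hpi : Integrable p μ := by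
    refine Integrable.of_bound
      (Complex.measurable_re.comp (hB.measurable_pullSource g)).aestronglyMeasurable 1
      (Filter.Eventually.of_forall fun x => ?_)
    rw [Real.norm_of_nonneg (hp01 x).1]
    exact (hp01 x).2
  simp only [hpg] at h1
  have h2 : ∫ x in fixSet B, p x ∂μ = 0 := by
    have h3 : ((∫ x in fixSet B, p x ∂μ : ℝ) : ℂ) = 0 := by
      rw [← h1]; exact integral_ofReal.symm
    exact_mod_cast h3
  have h4 : ∫ x in K, p x ∂μ = μ.real K := by
    rw [setIntegral_congr_fun (g := fun _ => (1 : ℝ)) hK.measurableSet]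
    · simp
    · intro x hx
      obtain ⟨β, hβ, rfl⟩ := fixSet_subset B (hKF hx)
      have h5 : (src β : UnitSpace G) ∈ (src '' B : Set (UnitSpace G)) := mem_image_of_mem _ hβ
      have h6 : φ β = 1 := hφ1 ⟨⟨β, hβ⟩, hx, rfl⟩
      simp only [hp, pullSource, dif_pos h5, hB.section_eq hβ h5]
      simp [hg, h6]
  have h7 : μ.real K ≤ 0 := by
    rw [← h4, ← h2]
    exact setIntegral_mono_set hpi.integrableOn (Filter.Eventually.of_forall fun x => (hp01 x).1)
      (Filter.Eventually.of_forall hKF)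
  have h8 : μ.real K = 0 := le_antisymm h7 measureReal_nonneg
  exact (measureReal_eq_zero_iff (measure_ne_top μ K)).1 h8

/-- A compact set of points moved by `α_B` is covered by finitely many open sets disjoint from
their images under `α_B`. -/
theorem IsPrecompactOpenBisection.exists_cover_moved {B : Set G}
    (hB : IsPrecompactOpenBisection B) {K : Set (UnitSpace G)} (hK : IsCompact K)
    (hKB : K ⊆ src '' B) (hKF : Disjoint K (fixSet B)) :
    ∃ (n : ℕ) (U : Fin n → Set (UnitSpace G)), (∀ i, IsOpen (U i)) ∧
      (∀ i, ∀ β ∈ B, src β ∈ U i → rng β ∉ U i) ∧ K ⊆ ⋃ i, U i := by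
  have hx : ∀ x : K, ∃ U : Set (UnitSpace G), IsOpen U ∧ x.1 ∈ U ∧
      ∀ β ∈ B, src β ∈ U → rng β ∉ U := by
    rintro ⟨x, hx⟩
    obtain ⟨β, hβ, rfl⟩ := hKB hx
    have hne : rng β ≠ src β := fun e =>
      disjoint_left.1 hKF hx ((hB.mem_fixSet hβ).2 e)
    obtain ⟨V, W, hV, hW, hrV, hsW, hVW⟩ := t2_separation hne
    refine ⟨W ∩ src '' (B ∩ rng ⁻¹' V), hW.inter (isOpen_src_image
      (hB.isOpen.inter (hV.preimage TopGpd.continuous_rng))), ⟨hsW, β, ⟨hβ, hrV⟩, rfl⟩, ?_⟩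
    rintro δ hδ ⟨-, ε, ⟨hε, hεV⟩, e⟩ ⟨hδW, -⟩
    obtain rfl := hB.isBisection.src_injOn hε hδ e
    exact disjoint_left.1 hVW hεV hδW
  choose U hUo hxU hU using hx
  obtain ⟨t, ht⟩ := hK.elim_finite_subcover U hUo fun x hx => mem_iUnion.2 ⟨⟨x, hx⟩, hxU _⟩
  refine ⟨t.card, fun i => U (t.equivFin.symm i), fun i => hUo _, fun i => hU _, fun x hx => ?_⟩
  obtain ⟨y, hy, hxy⟩ := mem_iUnion₂.1 (ht hx)
  exact mem_iUnion.2 ⟨t.equivFin ⟨y, hy⟩, by simpa using hxy⟩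

/-- Under essential freeness, a tracial state vanishes on functions supported in a bisection off
the unit space: cut the function by a partition of unity into parts over sets disjoint from their
image, on which the trace vanishes, and one part over a neighbourhood of `Fix(α_B)` of small
measure, on which it is small by Cauchy–Schwarz. -/
theorem IsTracialState.eq_zero_of_isEssentiallyFree {N : CStarNorm G}
    {τ : GroupoidCStar N →L[ℂ] ℂ} (hτ : IsTracialState τ) {μ : Measure (UnitSpace G)}
    [IsFiniteMeasure μ] [μ.Regular] (hτμ : IsAssociatedMeasure τ μ) {B : Set G}
    (hB : IsPrecompactOpenBisection B) (hF : μ (fixSet B) = 0) {g : Cc G}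
    (hg : tsupport g ⊆ B) : τ (GroupoidCStar.ofCc N g) = 0 := by
  have := locallyCompactSpace_units G
  set a := GroupoidCStar.ofCc N g with ha
  set C : ℝ := (τ (star (star a) * star a)).re with hC
  have hC0 : 0 ≤ C := (Complex.nonneg_iff.1 (hτ.nonneg (star a))).1
  have key : ∀ ε : ℝ, 0 < ε → ‖τ a‖ ^ 2 ≤ C * ε := by
    intro ε hε
    obtain ⟨W, hFW, hW, hWε⟩ := (fixSet B).exists_isOpen_lt_of_lt (ENNReal.ofReal ε)
      (by rw [hF]; exact ENNReal.ofReal_pos.2 hε)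
    set K : Set (UnitSpace G) := src '' tsupport g with hK
    have hKc : IsCompact K := g.hasCompactSupport.isCompact.image TopGpd.continuous_src
    obtain ⟨n, U, hUo, hU, hKU⟩ := hB.exists_cover_moved (hKc.diff hW)
      (sdiff_subset.trans (image_mono hg)) (disjoint_left.2 fun x hx hxF => hx.2 (hFW hxF))
    obtain ⟨h, hhs, hh1, hh01, hhc⟩ := exists_continuous_sum_one_of_isOpen_isCompact
      (s := Fin.cons W U) (t := K) (fun i => by
        refine Fin.cases ?_ (fun i => ?_) i
        · exact hW
        · exact hUo i) hKc (fun x hx => by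
        by_cases hxW : x ∈ W
        · exact mem_iUnion.2 ⟨0, hxW⟩
        · obtain ⟨i, hi⟩ := mem_iUnion.1 (hKU ⟨hx, hxW⟩)
          exact mem_iUnion.2 ⟨i.succ, hi⟩)
    set e : Fin (n + 1) → Cc G := fun i => extendZero (Cc.ofReal (h i) (hhc i)) with he
    have hsum : g = ∑ i, g * e i := by
      ext γ
      have h2 : (∑ i, g * e i) γ = g γ * ∑ i, (h i (src γ) : ℂ) := by
        rw [Cc.sum_apply, Finset.mul_sum]
        exact Finset.sum_congr rfl fun i _ => mul_extendZero g _ γ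
      rw [h2]
      by_cases h0 : g γ = 0
      · simp [h0]
      · have h1 := hh1 (mem_image_of_mem src (subset_tsupport _ h0))
        simp only [Finset.sum_apply, Pi.one_apply] at h1
        rw [← Complex.ofReal_sum, h1, Complex.ofReal_one, mul_one]
    have hi : ∀ i : Fin n, τ (GroupoidCStar.ofCc N (g * e i.succ)) = 0 := fun i =>
      hτ.map_mul_extendZero_eq_zero (hU i) hg _ _ (fun x => (hh01 _ x).1)
        fun x hx => hhs i.succ (subset_tsupport _ hx)
    have hτa : τ a = τ (star (star a) * GroupoidCStar.ofCc N (e 0)) := by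
      rw [star_star, ha, ← map_mul]
      conv_lhs => rw [hsum]
      rw [map_sum, map_sum, Fin.sum_univ_succ, Finset.sum_eq_zero fun i _ => hi i, add_zero]
    let k : C(UnitSpace G, ℝ) := ⟨fun x => h 0 x * h 0 x, by fun_prop⟩
    have hkc : HasCompactSupport k := (hhc 0).mul_right
    have hee : star (GroupoidCStar.ofCc N (e 0)) * GroupoidCStar.ofCc N (e 0) =
        GroupoidCStar.ofCc N (extendZero (Cc.ofReal k hkc)) := by
      rw [← map_star, ← map_mul, he, star_extendZero (g := Cc.ofReal (h 0) (hhc 0))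
        fun x => Complex.conj_ofReal _]
      refine congrArg _ (extendZero_mul_extendZero fun x => ?_)
      rw [Cc.ofReal_apply, Cc.ofReal_apply, ← Complex.ofReal_mul]
      rfl
    have hle : (τ (star (GroupoidCStar.ofCc N (e 0)) * GroupoidCStar.ofCc N (e 0))).re ≤ ε := by
      have h1 : ∫ x, (Cc.ofReal k hkc) x ∂μ = ((∫ x, k x ∂μ : ℝ) : ℂ) := integral_ofReal
      rw [hee, hτμ, h1, Complex.ofReal_re]
      have h2 : ∫ x, k x ∂μ ≤ ∫ x, W.indicator 1 x ∂μ := by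
        refine integral_mono (k.continuous.integrable_of_hasCompactSupport hkc)
          ((integrable_const (1 : ℝ)).indicator hW.measurableSet) fun x => ?_
        have h01 := hh01 0 x
        by_cases hx : x ∈ W
        · simp only [k, ContinuousMap.coe_mk, indicator_of_mem hx, Pi.one_apply]
          exact mul_le_one₀ h01.2 h01.1 h01.2
        · have h0 : h 0 x = 0 := by
            by_contra h0
            exact hx (hhs 0 (subset_tsupport _ h0))
          simp [k, h0, hx]
      rw [integral_indicator_one hW.measurableSet] at h2
      refine h2.trans ?_
      exact ENNReal.toReal_le_of_le_ofReal hε.le hWε.le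
    rw [hτa]
    exact (hτ.norm_sq_le _ _).trans (mul_le_mul_of_nonneg_left hle hC0)
  by_contra hne
  have hpos : 0 < ‖τ a‖ ^ 2 := by positivity
  have h1 := key (‖τ a‖ ^ 2 / (2 * (C + 1))) (by positivity)
  have h2 : C * (‖τ a‖ ^ 2 / (2 * (C + 1))) < ‖τ a‖ ^ 2 := by
    rw [← mul_div_assoc, div_lt_iff₀ (by positivity)]
    nlinarith
  linarith

/-- Under essential freeness, tracial states with associated measure `μ` are canonical. -/
theorem IsEssentiallyFree.isCanonical {μ : Measure (UnitSpace G)} [IsProbabilityMeasure μ]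
    [μ.Regular] (hfree : IsEssentiallyFree μ) {N : CStarNorm G} (hN : N.DominatesReduced)
    {τ : GroupoidCStar N →L[ℂ] ℂ} (hτ : IsTracialState τ) (hτμ : IsAssociatedMeasure τ μ) :
    IsCanonical hN τ := by
  refine ⟨μ, inferInstance, inferInstance, hτμ, eq_canonicalTrace hN ?_⟩
  let φ : Cc G →ₗ[ℂ] ℂ :=
    { toFun := fun f => τ (GroupoidCStar.ofCc N f)
      map_add' := fun f g => by rw [map_add, map_add]
      map_smul' := fun c f => by rw [map_smul, map_smul]; rfl }
  exact eq_integral_units φ μ hτμ fun B g hB hBu hg =>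
    hτ.eq_zero_of_isEssentiallyFree hτμ hB (hfree B hB hBu) hg

theorem IsEssentiallyFree.fixedPointTrace_eq {μ : Measure (UnitSpace G)} [IsFiniteMeasure μ]
    (hfree : IsEssentiallyFree μ) (g : Cc G) :
    fixedPointTrace μ g = ∫ x : UnitSpace G, g x ∂μ := by
  refine eq_integral_units _ μ (fixedPointTrace_extendZero μ) (fun B g hB hBu hg => ?_) g
  rw [fixedPointTrace_apply μ hB hg, Measure.restrict_eq_zero.2 (hfree B hB hBu),
    integral_zero_measure]

/-- If the fixed point trace extends to a canonical tracial state, then `G` is essentially free: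
a canonical trace vanishes on functions vanishing on the unit space. -/
theorem isEssentiallyFree_of_isCanonical {μ : Measure (UnitSpace G)} [IsFiniteMeasure μ]
    [μ.Regular] {N : CStarNorm G} (hN : N.DominatesReduced) {τ : GroupoidCStar N →L[ℂ] ℂ}
    (hτ : IsCanonical hN τ)
    (hfix : ∀ f : Cc G, τ (GroupoidCStar.ofCc N f) = fixedPointTrace μ f) :
    IsEssentiallyFree μ := by
  obtain ⟨ν, -, -, -, h⟩ := hτ
  refine isEssentiallyFree_of_fixedPointTrace fun g hg => ?_
  rw [← hfix, h, canonicalTrace]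
  simp only [quotientMap_ofCc, condExpUnits_ofCc, hg]
  simp

end EssentiallyFree

end EtaleGroupoid

theorem theorem3 {G : Type u} [TopologicalSpace G] [LocallyCompactSpace G] [T2Space G]
    [EtaleGroupoid.TopGpd G] [EtaleGroupoid.IsEtale G]
    [MeasurableSpace (EtaleGroupoid.UnitSpace G)] [BorelSpace (EtaleGroupoid.UnitSpace G)]
    (μ : MeasureTheory.Measure (EtaleGroupoid.UnitSpace G))
    [MeasureTheory.IsProbabilityMeasure μ] [μ.Regular] (hμ : EtaleGroupoid.IsInvariant μ) :
    List.TFAE [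
      -- (1) `G` is essentially free with respect to `μ`
      EtaleGroupoid.IsEssentiallyFree μ,
      -- (2) for any C*-norm `N` dominating the reduced one
      ∀ (N : EtaleGroupoid.CStarNorm G) (hN : N.DominatesReduced),
        (∀ τ : EtaleGroupoid.GroupoidCStar N →L[ℂ] ℂ, EtaleGroupoid.IsTracialState τ →
          EtaleGroupoid.IsAssociatedMeasure τ μ → EtaleGroupoid.IsCanonical hN τ) ∧
        (∃ τ : EtaleGroupoid.GroupoidCStar N →L[ℂ] ℂ, EtaleGroupoid.IsTracialState τ ∧
          ∀ f : EtaleGroupoid.Cc G,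
            τ (EtaleGroupoid.GroupoidCStar.ofCc N f) = EtaleGroupoid.fixedPointTrace μ f),
      -- (3) for some C*-norm `N` dominating the reduced one
      ∃ (N : EtaleGroupoid.CStarNorm G) (hN : N.DominatesReduced),
        (∀ τ : EtaleGroupoid.GroupoidCStar N →L[ℂ] ℂ, EtaleGroupoid.IsTracialState τ →
          EtaleGroupoid.IsAssociatedMeasure τ μ → EtaleGroupoid.IsCanonical hN τ) ∧
        (∃ τ : EtaleGroupoid.GroupoidCStar N →L[ℂ] ℂ, EtaleGroupoid.IsTracialState τ ∧
          ∀ f : EtaleGroupoid.Cc G,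
            τ (EtaleGroupoid.GroupoidCStar.ofCc N f) = EtaleGroupoid.fixedPointTrace μ f),
      -- (4) for the maximal C*-algebra
      ∀ τ : EtaleGroupoid.GroupoidCStar (EtaleGroupoid.maxNorm G) →L[ℂ] ℂ,
        EtaleGroupoid.IsTracialState τ → EtaleGroupoid.IsAssociatedMeasure τ μ →
          EtaleGroupoid.IsCanonical EtaleGroupoid.maxNorm_dominatesReduced τ] := by
  -- a functional extending the fixed point trace has associated measure `μ`
  have hassoc : ∀ (N : EtaleGroupoid.CStarNorm G) (τ : EtaleGroupoid.GroupoidCStar N →L[ℂ] ℂ),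
      (∀ f : EtaleGroupoid.Cc G,
        τ (EtaleGroupoid.GroupoidCStar.ofCc N f) = EtaleGroupoid.fixedPointTrace μ f) →
      EtaleGroupoid.IsAssociatedMeasure τ μ := fun N τ hτ f => by
    rw [hτ, EtaleGroupoid.fixedPointTrace_extendZero]
  tfae_have 1 → 2 := fun hfree N hN => by
    refine ⟨fun τ hτ hτμ => hfree.isCanonical hN hτ hτμ,
      EtaleGroupoid.exists_tracialState_extension N (EtaleGroupoid.fixedPointTrace μ) (fun f => ?_)
        (EtaleGroupoid.fixedPointTrace_nonneg μ) (EtaleGroupoid.fixedPointTrace_mul_comm hμ) μ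
        (EtaleGroupoid.fixedPointTrace_extendZero μ)⟩
    rw [hfree.fixedPointTrace_eq]
    refine (MeasureTheory.norm_integral_le_of_norm_le_const (C := N.toSeminorm f)
      (Filter.Eventually.of_forall fun x => ?_)).trans (by simp)
    rw [← EtaleGroupoid.condExpUnits_ofCc]
    exact (EtaleGroupoid.norm_condExpUnits_le _ x).trans
      ((EtaleGroupoid.GroupoidCStar.norm_coeL _ _).le.trans (hN f))
  tfae_have 2 → 3 := fun h =>
    ⟨EtaleGroupoid.reducedNorm G, fun _ => le_rfl, h _ _⟩
  tfae_have 3 → 1 := by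
    rintro ⟨N, hN, hcan, τ, hτ, hfix⟩
    exact EtaleGroupoid.isEssentiallyFree_of_isCanonical hN (hcan τ hτ (hassoc N τ hfix)) hfix
  tfae_have 1 → 4 := fun hfree τ hτ hτμ => hfree.isCanonical _ hτ hτμ
  tfae_have 4 → 1 := fun hcan => by
    obtain ⟨τ, hτ, hfix⟩ := EtaleGroupoid.exists_tracialState_extension (EtaleGroupoid.maxNorm G)
      (EtaleGroupoid.fixedPointTrace μ) (EtaleGroupoid.norm_fixedPointTrace_le μ)
      (EtaleGroupoid.fixedPointTrace_nonneg μ) (EtaleGroupoid.fixedPointTrace_mul_comm hμ) μ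
      (EtaleGroupoid.fixedPointTrace_extendZero μ)
    exact EtaleGroupoid.isEssentiallyFree_of_isCanonical _ (hcan τ hτ (hassoc _ τ hfix)) hfix
  tfae_finish
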